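/- **Setting.** A *weight sequence* is $M=(M_k)_{k\ge 0}$ with all $M_k>0$; put $m_k=M_k/k!$, $\mu_0=1$, $\mu_k=M_k/M_{k-1}$ for $k\ge1$ (similarly $n_k$ for $N$, and so on). $\mathcal{LC}$ is the set of weight sequences with $1=M_0\le M_1$, $M_j^2\le M_{j-1}M_{j+1}$ for $j\ge 1$, and $\lim_k M_k^{1/k}=+\infty$. Write $M\preceq N$ if there are $C_1,C_2\ge1$ with $M_p\le C_2C_1^pN_p$ for all $p$, and $M\approx N$ if $M\preceq N$ and $N\preceq M$. $M$ has (mg) if there is $C\ge1$ with $M_{j+k}\le C^{j+k}M_jM_k$ for all $j,k\in\mathbb N$, and $(\beta_3)$ if $\liminf_{p\to\infty}\mu_{Qp}/\mu_p>1$ for some integer $Q\ge1$. $\mathcal W$ is the set of continuous, non-decreasing $\omega:[0,\infty)\to[0,\infty)$ with $\omega=0$ on $[0,1]$, $\lim_{t\to\infty}\omega(t)=+\infty$, $\omega(2t)=O(\omega(t))$ and $\log t=o(\omega(t))$ as $t\to\infty$, and $\varphi_\omega:t\mapsto\omega(e^t)$ convex on $\mathbb R$. Conditions: $(\omega_2)$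 $\omega(t)=O(t)$; $(\omega_5)$ $\omega(t)=o(t)$, both as $t\to\infty$; $(\omega_6)$ there is $H\ge1$ with $2\omega(t)\le\omega(Ht)+H$ for all $t\ge0$. Put $\varphi^*_\omega(x)=\sup_{y\ge0}(xy-\varphi_\omega(y))$ for $x\ge0$, $\Omega^l_j=\exp\bigl(\tfrac1l\varphi^*_\omega(lj)\bigr)$ and $\Omega=\{\Omega^l:l>0\}$. For $N\in\mathcal{LC}$ put $\omega_N(t)=\sup_{p\in\mathbb N}\log(t^pN_0/N_p)$ for $t>0$ and $\omega_N(0)=0$. For $U\subseteq\mathbb R^r$ non-empty open, $K\subseteq U$ compact and $f\in C^\infty(U,\mathbb R^s)$ let $$\|f\|_{M,K,h}=\sup_{k\in\mathbb N,\,x\in K}\frac{\|f^{(k)}(x)\|}{h^kM_k},\qquad \|f\|_{\omega,K,l}=\sup_{k\in\mathbb N,\,x\in K}\frac{\|f^{(k)}(x)\|}{\exp(\frac1l\varphi^*_\omega(lk))}.$$ The Roumieu class $\mathcal E_{\{M\}}(U,\mathbb R^s)$ (resp. $\mathcal E_{\{\omega\}}$, $\mathcal E_{\{\Omega\}}$)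 consists of the smooth $f$ such that for every compact $K\subseteq U$ there is $h>0$ with $\|f\|_{M,K,h}<\infty$ (resp. there is $l>0$ with $\|f\|_{\omega,K,l}<\infty$; resp. there are $l,h>0$ with $\|f\|_{\Omega^l,K,h}<\infty$). The Beurling classes $\mathcal E_{(M)},\mathcal E_{(\omega)},\mathcal E_{(\Omega)}$ are defined with "for all" in place of "there is/are". $\mathcal E_{[\cdot]}$ stands for either type, the same one throughout a statement; an equality of classes means equality for all $r,s\ge1$ and all non-empty open $U\subseteq\mathbb R^r$. **Theorem.** Let $\omega\in\mathcal W$. For each of the two types the following are equivalent: (i) there exists $N\in\mathcal{LC}$ with $\mathcal E_{[N]}=\mathcal E_{[\omega]}=\mathcal E_{[\Omega]}$; (ii) $\omega$ has $(\omega_6)$; (iii) there exists $N\in\mathcal{LC}$ such that $\mathcal E_{[\Omega^l]}=\mathcal E_{[N]}$ for each $l>0$, or equivalently $N\approx\Omega^l$ for each $l>0$. (For every $N\in\mathcal{LC}$ and $l>0$, $\mathcal E_{[\Omega^l]}=\mathcal E_{[N]}$ if and only if $N\approx\Omega^l$.) Moreover, for every $N$ as in (i) or as in (iii): (a) $N$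 and each $\Omega^l$ satisfy (mg). (b) If $\omega$ has $(\omega_2)$, then $\liminf_{p\to\infty}(n_p)^{1/p}>0$; $\liminf_{k\to\infty}(\Omega^l_k/k!)^{1/k}>0$ for all $l>0$ (condition $(\mathcal M_{\mathcal H})$ for $\Omega$); $\omega_N$ and each $\omega_{\Omega^l}$ satisfy $(\omega_2)$; $N$ and each $\Omega^l$ have $(\beta_3)$; and $\mathcal E_{[\omega_N]}=\mathcal E_{[N]}=\mathcal E_{[\omega]}=\mathcal E_{[\Omega^l]}$ for each $l>0$. If $\omega$ has $(\omega_5)$, then $\lim_{p\to\infty}(n_p)^{1/p}=+\infty$; $\lim_{k\to\infty}(\Omega^l_k/k!)^{1/k}=+\infty$ for all $l>0$; and $\omega_N$ and each $\omega_{\Omega^l}$ satisfy $(\omega_5)$. -/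

import Mathlib

open Filter Topology Asymptotics
open scoped ENNReal Nat

noncomputable section

namespace Ultra

/-! ### Weight sequences -/

/-- Normalized log-convex sequences of positive reals with `(M_k)^{1/k} → ∞`. -/
structure IsLC (M : ℕ → ℝ) : Prop where
  pos : ∀ k, 0 < M k
  zero_eq_one : M 0 = 1
  one_le : 1 ≤ M 1
  logConvex : ∀ j, M (j + 1) ^ 2 ≤ M j * M (j + 2)
  root_tendsto : Tendsto (fun k : ℕ => M k ^ (1 / (k : ℝ))) atTop atTop

/-- `M ≼ N`. -/
def SeqLE (M N : ℕ → ℝ) : Prop :=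
  ∃ C₁ C₂ : ℝ, 1 ≤ C₁ ∧ 1 ≤ C₂ ∧ ∀ p, M p ≤ C₂ * C₁ ^ p * N p

/-- `M ≈ N`. -/
def SeqEquiv (M N : ℕ → ℝ) : Prop := SeqLE M N ∧ SeqLE N M

/-- Moderate growth (mg). -/
def ModerateGrowth (M : ℕ → ℝ) : Prop :=
  ∃ C : ℝ, 1 ≤ C ∧ ∀ j k, M (j + k) ≤ C ^ (j + k) * M j * M k

/-- The quotients `μ_k = M_k / M_{k-1}`, with `μ_0 = 1`. -/
def quot (M : ℕ → ℝ) : ℕ → ℝ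
  | 0 => 1
  | k + 1 => M (k + 1) / M k

/-- Condition `(β₃)`. The lower limit is taken in `[0, ∞]`. -/
def Beta3 (M : ℕ → ℝ) : Prop :=
  ∃ Q : ℕ, 0 < Q ∧
    1 < liminf (fun p : ℕ => ENNReal.ofReal (quot M (Q * p) / quot M p)) atTop

/-- The sequence `(m_k)^{1/k}`, where `m_k = M_k / k!`. -/
def smallRoot (M : ℕ → ℝ) (k : ℕ) : ℝ := (M k / (k ! : ℝ)) ^ (1 / (k : ℝ))

/-- `liminf (m_k)^{1/k} > 0`. The lower limit is taken in `[0, ∞]`. -/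
def LiminfPos (M : ℕ → ℝ) : Prop :=
  0 < liminf (fun k : ℕ => ENNReal.ofReal (smallRoot M k)) atTop

/-- `lim (m_k)^{1/k} = +∞`. -/
def LimInfty (M : ℕ → ℝ) : Prop := Tendsto (smallRoot M) atTop atTop

/-- `(M_H)` for a weight matrix `(M^x)_{x ∈ Λ}`. -/
def MatrixH {Λ : Type} (M : Λ → ℕ → ℝ) : Prop := ∀ x, LiminfPos (M x)

/-- `(M_(C^ω))` (Beurling type) for a weight matrix `(M^x)_{x ∈ Λ}`. -/
def MatrixBeurlingAnalytic {Λ : Type} (M : Λ → ℕ → ℝ) : Prop := ∀ x, LimInfty (M x)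

/-! ### Weight functions

A function `[0, ∞) → [0, ∞)` is represented by a function `ω : ℝ → ℝ`; no condition and no
construction below uses its values on negative reals. -/

/-- The set `𝒲`: weight functions with `(ω₀)`, `(ω₁)`, `(ω₃)`, `(ω₄)`. -/
structure IsW (ω : ℝ → ℝ) : Prop where
  nonneg : ∀ t, 0 ≤ t → 0 ≤ ω t
  cont : ContinuousOn ω (Set.Ici 0)
  mono : MonotoneOn ω (Set.Ici 0)
  zero_on : ∀ t ∈ Set.Icc (0 : ℝ) 1, ω t = 0
  tendsto : Tendsto ω atTop atTop
  om1 : (fun t => ω (2 * t)) =O[atTop] ω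
  om3 : Real.log =o[atTop] ω
  om4 : ConvexOn ℝ Set.univ (fun t : ℝ => ω (Real.exp t))

/-- `(ω₂)`. -/
def Om2 (ω : ℝ → ℝ) : Prop := ω =O[atTop] (fun t : ℝ => t)

/-- `(ω₅)`. -/
def Om5 (ω : ℝ → ℝ) : Prop := ω =o[atTop] (fun t : ℝ => t)

/-- `(ω₆)`. -/
def Om6 (ω : ℝ → ℝ) : Prop :=
  ∃ H : ℝ, 1 ≤ H ∧ ∀ t, 0 ≤ t → 2 * ω t ≤ ω (H * t) + H

/-- The Young conjugate `φ*_ω(x) = sup {x y - ω(e^y) : y ≥ 0}`, used for `x ≥ 0`. The supremum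
is finite if `log t = o(ω(t))`, see `bddAbove_young`. -/
def young (ω : ℝ → ℝ) (x : ℝ) : ℝ :=
  sSup ((fun y : ℝ => x * y - ω (Real.exp y)) '' Set.Ici 0)

/-- The sequences `Ω^l_j = exp (φ*_ω(l j) / l)`. -/
def Omega (ω : ℝ → ℝ) (l : ℝ) (j : ℕ) : ℝ := Real.exp (1 / l * young ω (l * j))

/-- The weight matrix `Ω = {Ω^l : l > 0}`. -/
def OmegaMatrix (ω : ℝ → ℝ) (l : Set.Ioi (0 : ℝ)) : ℕ → ℝ := Omega ω l

/-- The associated function `ω_M(t) = sup_p log (t^p M_0 / M_p)` for `t > 0`, `ω_M(0) = 0`. The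
supremum is finite if `(M_p)^{1/p} → ∞`, see `bddAbove_assoc`. -/
def assoc (M : ℕ → ℝ) (t : ℝ) : ℝ :=
  if 0 < t then ⨆ p : ℕ, Real.log (t ^ p * M 0 / M p) else 0

theorem bddAbove_young {ω : ℝ → ℝ} (hω : IsW ω) (x : ℝ) :
    BddAbove ((fun y : ℝ => x * y - ω (Real.exp y)) '' Set.Ici 0) := by
  have h := (hω.om3.comp_tendsto Real.tendsto_exp_atTop).def
    (c := 1 / (|x| + 1)) (by positivity)
  obtain ⟨A, hA⟩ := eventually_atTop.1 h
  refine ⟨|x| * |A|, ?_⟩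
  rintro _ ⟨y, hy, rfl⟩
  have hy' : (0 : ℝ) ≤ y := hy
  have h0 : 0 ≤ ω (Real.exp y) := hω.nonneg _ (Real.exp_pos y).le
  have hxy : x * y ≤ |x| * y := mul_le_mul_of_nonneg_right (le_abs_self x) hy'
  rcases le_total A y with hAy | hAy
  · have := hA y hAy
    simp only [Function.comp, Real.log_exp, Real.norm_eq_abs, abs_of_nonneg hy',
      abs_of_nonneg h0] at this
    rw [div_mul_eq_mul_div, one_mul, le_div_iff₀ (by positivity)] at this
    have h2 : 0 ≤ |x| * |A| := by positivity
    show x * y - ω (Real.exp y) ≤ _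
    nlinarith
  · have h3 : |x| * y ≤ |x| * |A| :=
      mul_le_mul_of_nonneg_left (hAy.trans (le_abs_self A)) (abs_nonneg x)
    show x * y - ω (Real.exp y) ≤ _
    linarith

theorem bddAbove_assoc {M : ℕ → ℝ} (hM : IsLC M) {t : ℝ} (ht : 0 < t) :
    BddAbove (Set.range fun p : ℕ => Real.log (t ^ p * M 0 / M p)) := by
  have h : ∀ᶠ p : ℕ in atTop, Real.log (t ^ p * M 0 / M p) ≤ 0 := by
    filter_upwards [hM.root_tendsto.eventually_ge_atTop t, eventually_ge_atTop 1] with p hp hp1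
    have hpos := hM.pos p
    rw [hM.zero_eq_one, mul_one]
    refine Real.log_nonpos (by positivity) ((div_le_one hpos).2 ?_)
    calc t ^ p ≤ (M p ^ (1 / (p : ℝ))) ^ p := by gcongr
      _ = M p := by
        rw [one_div]; exact Real.rpow_inv_natCast_pow hpos.le (by omega)
  exact (isBoundedUnder_of_eventually_le h).bddAbove_range

/-! ### Classes of ultradifferentiable functions -/

/-- `ℝⁿ` with the Euclidean norm. -/
abbrev E (n : ℕ) : Type := EuclideanSpace ℝ (Fin n)

/-- `f` is smooth (of class `C^∞`) on `U`. -/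
def SmoothOn {r s : ℕ} (f : E r → E s) (U : Set (E r)) : Prop :=
  ContDiffOn ℝ ((⊤ : ℕ∞) : WithTop ℕ∞) f U

/-- `sup {‖f^{(k)}(x)‖ / w_k : k ∈ ℕ, x ∈ K}` in `[0, ∞]`, with the Fréchet derivatives `f^{(k)}`
and their operator norms as `k`-linear maps. -/
def supNorm {r s : ℕ} (f : E r → E s) (K : Set (E r)) (w : ℕ → ℝ) : ℝ≥0∞ :=
  ⨆ (k : ℕ) (x ∈ K), ENNReal.ofReal (‖iteratedFDeriv ℝ k f x‖ / w k)

/-- `‖f‖_{M,K,h}`. -/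
def seqNorm {r s : ℕ} (M : ℕ → ℝ) (h : ℝ) (f : E r → E s) (K : Set (E r)) : ℝ≥0∞ :=
  supNorm f K (fun k => h ^ k * M k)

/-- `‖f‖_{ω,K,l}`. -/
def weightNorm {r s : ℕ} (ω : ℝ → ℝ) (l : ℝ) (f : E r → E s) (K : Set (E r)) : ℝ≥0∞ :=
  supNorm f K (fun k => Real.exp (1 / l * young ω (l * k)))

/-- The two types of classes: `{·}` (Roumieu) and `(·)` (Beurling). -/
inductive ClassType
  | roumieu
  | beurling

/-- A function class assigns to each `U ⊆ ℝ^r` and each `s` a set of functions `U → ℝ^s`. A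
function on `U` is represented by an arbitrary extension to `ℝ^r`; for open `U` membership in the
classes below depends only on the restriction to `U`. -/
abbrev FunClass : Type := ∀ r s : ℕ, Set (E r) → Set (E r → E s)

/-- `E_{M}` and `E_(M)`. -/
def seqClass (M : ℕ → ℝ) : ClassType → FunClass
  | .roumieu => fun _ _ U => {f | SmoothOn f U ∧
      ∀ K ⊆ U, IsCompact K → ∃ h : ℝ, 0 < h ∧ seqNorm M h f K < ∞}
  | .beurling => fun _ _ U => {f | SmoothOn f U ∧
      ∀ K ⊆ U, IsCompact K → ∀ h : ℝ, 0 < h → seqNorm M h f K < ∞}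

/-- `E_{ω}` and `E_(ω)`. -/
def weightClass (ω : ℝ → ℝ) : ClassType → FunClass
  | .roumieu => fun _ _ U => {f | SmoothOn f U ∧
      ∀ K ⊆ U, IsCompact K → ∃ l : ℝ, 0 < l ∧ weightNorm ω l f K < ∞}
  | .beurling => fun _ _ U => {f | SmoothOn f U ∧
      ∀ K ⊆ U, IsCompact K → ∀ l : ℝ, 0 < l → weightNorm ω l f K < ∞}

/-- The classes of Roumieu and Beurling type of a weight matrix `(M^x)_{x ∈ Λ}`. -/
def matrixClass {Λ : Type} (M : Λ → ℕ → ℝ) : ClassType → FunClass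
  | .roumieu => fun _ _ U => {f | SmoothOn f U ∧
      ∀ K ⊆ U, IsCompact K → ∃ x : Λ, ∃ h : ℝ, 0 < h ∧ seqNorm (M x) h f K < ∞}
  | .beurling => fun _ _ U => {f | SmoothOn f U ∧
      ∀ K ⊆ U, IsCompact K → ∀ x : Λ, ∀ h : ℝ, 0 < h → seqNorm (M x) h f K < ∞}

/-- Two classes coincide if they do on all non-empty open `U ⊆ ℝ^r` and for all targets `ℝ^s`,
`r, s ≥ 1`. -/
def SameClass (A B : FunClass) : Prop :=
  ∀ r s : ℕ, 0 < r → 0 < s → ∀ U : Set (E r), IsOpen U → U.Nonempty → A r s U = B r s U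

end Ultra

end

open Ultra

noncomputable section

namespace Ultra

/-! ### Exponential sums with prescribed derivatives at the origin -/

/-- Sequences of power moments `∑ c_j t_j^k` of a discrete measure on `[0, ∞)`. -/
def IsMoment (a : ℕ → ℝ) : Prop :=
  ∃ c t : ℕ → ℝ, (∀ j, 0 ≤ c j) ∧ (∀ j, 0 ≤ t j) ∧ ∀ k, HasSum (fun j => c j * t j ^ k) (a k)

/-- The function `x ↦ c e^{i t x}`. -/
def wave (c t : ℝ) (x : ℝ) : ℂ := c * Complex.exp (t * Complex.I * x)

theorem iteratedDeriv_wave (c t : ℝ) (k : ℕ) :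
    iteratedDeriv k (wave c t) = fun x => (t * Complex.I) ^ k * wave c t x := by
  induction k with
  | zero => simp
  | succ k ih =>
    rw [iteratedDeriv_succ, ih]
    funext x
    have h1 : HasDerivAt (fun x : ℝ => (t * Complex.I * x : ℂ)) (t * Complex.I * 1) x :=
      (Complex.ofRealCLM.hasDerivAt (x := x)).const_mul _
    have h2 : HasDerivAt (wave c t) (c * (Complex.exp (t * Complex.I * x) * (t * Complex.I * 1))) x :=
      h1.cexp.const_mul _
    rw [(h2.const_mul _).deriv, wave]
    ring

theorem contDiff_wave (c t : ℝ) {n : WithTop ℕ∞} : ContDiff ℝ n (wave c t) := by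
  unfold wave
  have : ContDiff ℝ n (fun x : ℝ => (x : ℂ)) := Complex.ofRealCLM.contDiff
  fun_prop

theorem norm_iteratedFDeriv_wave {c t : ℝ} (hc : 0 ≤ c) (ht : 0 ≤ t) (k : ℕ) (x : ℝ) :
    ‖iteratedFDeriv ℝ k (wave c t) x‖ = c * t ^ k := by
  rw [norm_iteratedFDeriv_eq_norm_iteratedDeriv, iteratedDeriv_wave]
  have : ‖Complex.exp (t * Complex.I * x)‖ = 1 := by
    rw [show (t * Complex.I * x : ℂ) = ((t * x : ℝ) : ℂ) * Complex.I by push_cast; ring]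
    exact Complex.norm_exp_ofReal_mul_I _
  simp only [wave, norm_mul, this]
  simp [abs_of_nonneg hc, abs_of_nonneg ht, mul_comm]

/-- A moment sequence is realized by the derivatives at `0` of a function on the line, which
dominate the derivatives at all other points. -/
theorem IsMoment.exists_function {a : ℕ → ℝ} (ha : IsMoment a) :
    ∃ f : E 1 → E 2, ContDiff ℝ ((⊤ : ℕ∞) : WithTop ℕ∞) f ∧
      (∀ k x, ‖iteratedFDeriv ℝ k f x‖ ≤ a k) ∧ ∀ k, ‖iteratedFDeriv ℝ k f 0‖ = a k := by
  obtain ⟨c, t, hc, ht, hs⟩ := ha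
  let g : ℝ → ℂ := fun x => ∑' j, wave (c j) (t j) x
  have hsm : ∀ k : ℕ, (k : ℕ∞) ≤ ⊤ → Summable fun j => c j * t j ^ k := fun k _ => (hs k).summable
  have hb : ∀ (k j : ℕ) (x : ℝ), (k : ℕ∞) ≤ ⊤ →
      ‖iteratedFDeriv ℝ k (wave (c j) (t j)) x‖ ≤ c j * t j ^ k :=
    fun k j x _ => (norm_iteratedFDeriv_wave (hc j) (ht j) k x).le
  have hg : ContDiff ℝ ((⊤ : ℕ∞) : WithTop ℕ∞) g :=
    contDiff_tsum (fun j => contDiff_wave _ _) hsm hb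
  have hd : ∀ k, iteratedFDeriv ℝ k g = fun x => ∑' j, iteratedFDeriv ℝ k (wave (c j) (t j)) x :=
    fun k => iteratedFDeriv_tsum (fun j => contDiff_wave _ _) hsm hb le_top
  have hgle : ∀ k x, ‖iteratedFDeriv ℝ k g x‖ ≤ a k := fun k x => by
    rw [hd]
    exact tsum_of_norm_bounded (hs k) fun j => hb k j x le_top
  have hg0 : ∀ k, ‖iteratedFDeriv ℝ k g 0‖ = a k := fun k => by
    refine le_antisymm (hgle k 0) ?_
    have hsum : Summable fun j => iteratedFDeriv ℝ k (wave (c j) (t j)) 0 :=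
      Summable.of_norm_bounded (hsm k le_top) fun j => hb k j 0 le_top
    -- At 0 the k-th derivatives of all waves share the phase i^k, so nothing cancels in the sum.
    have h1 : iteratedDeriv k g 0 = Complex.I ^ k * (a k : ℂ) := by
      rw [iteratedDeriv_eq_iteratedFDeriv, hd]
      have h2 := (ContinuousMultilinearMap.apply ℝ (fun _ : Fin k => ℝ) ℂ (fun _ => 1)).hasSum
        hsum.hasSum
      refine h2.unique ?_
      have h3 := ((Complex.hasSum_ofReal.2 (hs k)).mul_left (Complex.I ^ k))
      refine h3.congr_fun fun j => ?_
      simp only [ContinuousMultilinearMap.apply_apply]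
      rw [← iteratedDeriv_eq_iteratedFDeriv, iteratedDeriv_wave]
      simp [wave]
      ring
    rw [norm_iteratedFDeriv_eq_norm_iteratedDeriv, h1]
    simpa using le_abs_self _
  -- Linear isometries ℂ ≅ ℝ² and ℝ¹ ≅ ℝ carry `g` over without changing the norms of its
  -- derivatives.
  let e := Complex.orthonormalBasisOneI.repr
  let p : E 1 ≃ₗᵢ[ℝ] ℝ := (EuclideanSpace.basisFun (Fin 1) ℝ).equiv
    (OrthonormalBasis.singleton (Fin 1) ℝ) (Equiv.refl _)
  have hn : ∀ k x, ‖iteratedFDeriv ℝ k (e ∘ (g ∘ p)) x‖ = ‖iteratedFDeriv ℝ k g (p x)‖ :=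
    fun k x => by
      rw [e.norm_iteratedFDeriv_comp_left, p.norm_iteratedFDeriv_comp_right]
  refine ⟨e ∘ (g ∘ p), e.contDiff.comp (hg.comp p.contDiff), fun k x => ?_, fun k => ?_⟩
  · rw [hn]; exact hgle _ _
  · rw [hn, map_zero]; exact hg0 k

/-! ### Domination of sequences -/

/-- The sequence `h^k M_k`. -/
def scaled (M : ℕ → ℝ) (h : ℝ) (k : ℕ) : ℝ := h ^ k * M k

/-- `a = O(w)`, uniformly in the index. -/
def Dominated (a w : ℕ → ℝ) : Prop := ∃ C : ℝ, ∀ k, a k ≤ C * w k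

theorem Dominated.trans {a b w : ℕ → ℝ} (hb : ∀ k, 0 ≤ b k)
    (h₁ : Dominated a b) (h₂ : Dominated b w) : Dominated a w := by
  obtain ⟨C, hC⟩ := h₁
  obtain ⟨D, hD⟩ := h₂
  refine ⟨|C| * D, fun k => (hC k).trans ?_⟩
  calc C * b k ≤ |C| * b k := by gcongr; exacts [hb k, le_abs_self C]
    _ ≤ |C| * (D * w k) := by gcongr; exact hD k
    _ = |C| * D * w k := by ring

theorem Dominated.of_le {a w : ℕ → ℝ} (h : ∀ k, a k ≤ w k) : Dominated a w :=
  ⟨1, fun k => by simpa using h k⟩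

theorem Dominated.rescale {a w : ℕ → ℝ} {g h : ℝ} (hg : 0 < g)
    (H : Dominated (scaled a h) w) : Dominated (scaled a (g * h)) (scaled w g) := by
  obtain ⟨C, hC⟩ := H
  refine ⟨C, fun k => ?_⟩
  calc (g * h) ^ k * a k = g ^ k * (h ^ k * a k) := by rw [mul_pow]; ring
    _ ≤ g ^ k * (C * w k) := mul_le_mul_of_nonneg_left (hC k) (by positivity)
    _ = C * (g ^ k * w k) := by ring

theorem SeqLE.of_dominated {M N : ℕ → ℝ} (hN : ∀ k, 0 ≤ N k) {h : ℝ} (hh : 0 < h)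
    (H : Dominated M (scaled N h)) : SeqLE M N := by
  obtain ⟨C, hC⟩ := H
  refine ⟨max h 1, max C 1, le_max_right _ _, le_max_right _ _, fun k => (hC k).trans ?_⟩
  rw [scaled, ← mul_assoc]
  have := hN k
  have h1 : h ≤ max h 1 := le_max_left _ _
  have h2 : C ≤ max C 1 := le_max_left _ _
  have h3 : (0 : ℝ) < max C 1 := lt_max_of_lt_right one_pos
  gcongr

theorem SeqLE.dominated {M N : ℕ → ℝ} (H : SeqLE M N) :
    ∃ h : ℝ, 0 < h ∧ Dominated M (scaled N h) := by
  obtain ⟨C₁, C₂, h₁, _, h⟩ := H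
  exact ⟨C₁, by linarith, C₂, fun k => by rw [scaled, ← mul_assoc]; exact h k⟩

theorem scaled_pos {M : ℕ → ℝ} (hM : ∀ k, 0 < M k) {h : ℝ} (hh : 0 < h) (k : ℕ) :
    0 < scaled M h k := mul_pos (pow_pos hh k) (hM k)

theorem scaled_one (M : ℕ → ℝ) : scaled M 1 = M := by
  funext k
  simp [scaled]

theorem scaled_scaled (M : ℕ → ℝ) (g h : ℝ) : scaled (scaled M h) g = scaled M (g * h) := by
  funext k
  simp [scaled, mul_pow, mul_assoc]

theorem SeqLE.trans {L M N : ℕ → ℝ} (h₁ : SeqLE L M) (h₂ : SeqLE M N) : SeqLE L N := by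
  obtain ⟨A, B, hA, hB, h⟩ := h₁
  obtain ⟨C, D, hC, hD, h'⟩ := h₂
  refine ⟨A * C, B * D, one_le_mul_of_one_le_of_one_le hA hC,
    one_le_mul_of_one_le_of_one_le hB hD, fun p => (h p).trans ?_⟩
  calc B * A ^ p * M p ≤ B * A ^ p * (D * C ^ p * N p) := by gcongr; exact h' p
    _ = B * D * (A * C) ^ p * N p := by rw [mul_pow]; ring

theorem SeqEquiv.symm {M N : ℕ → ℝ} (h : SeqEquiv M N) : SeqEquiv N M := ⟨h.2, h.1⟩

theorem SeqEquiv.trans {L M N : ℕ → ℝ} (h₁ : SeqEquiv L M) (h₂ : SeqEquiv M N) : SeqEquiv L N :=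
  ⟨h₁.1.trans h₂.1, h₂.2.trans h₁.2⟩

/-! ### Classes defined by a family of weights -/

theorem supNorm_lt_top_iff {r s : ℕ} {f : E r → E s} {K : Set (E r)} {w : ℕ → ℝ}
    (hw : ∀ k, 0 < w k) :
    supNorm f K w < ∞ ↔ ∃ C : ℝ, ∀ k, ∀ x ∈ K, ‖iteratedFDeriv ℝ k f x‖ ≤ C * w k := by
  constructor
  · intro h
    refine ⟨(supNorm f K w).toReal, fun k x hx => ?_⟩
    rw [← div_le_iff₀ (hw k), ← ENNReal.ofReal_le_iff_le_toReal h.ne]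
    exact le_iSup_of_le k (le_iSup₂_of_le x hx le_rfl)
  · rintro ⟨C, hC⟩
    refine lt_of_le_of_lt (iSup_le fun k => iSup₂_le fun x hx => ?_) (ENNReal.ofReal_lt_top (r := C))
    exact ENNReal.ofReal_le_ofReal ((div_le_iff₀ (hw k)).2 (hC k x hx))

theorem supNorm_lt_top_of_dominated {r s : ℕ} {f : E r → E s} {K : Set (E r)} {v w : ℕ → ℝ}
    (hv : ∀ k, 0 < v k) (hw : ∀ k, 0 < w k) (h : Dominated v w) (hf : supNorm f K v < ∞) :
    supNorm f K w < ∞ := by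
  rw [supNorm_lt_top_iff hv] at hf
  rw [supNorm_lt_top_iff hw]
  obtain ⟨C, hC⟩ := hf
  obtain ⟨D, hD⟩ := h
  refine ⟨|C| * D, fun k x hx => (hC k x hx).trans ?_⟩
  calc C * v k ≤ |C| * v k := by gcongr; exacts [(hv k).le, le_abs_self C]
    _ ≤ |C| * (D * w k) := by gcongr; exact hD k
    _ = |C| * D * w k := by ring

/-- The class of smooth functions whose derivatives are bounded on compact sets by one, or by each,
of the weights of a family. -/
def famClass {Λ : Type} (W : Λ → ℕ → ℝ) : ClassType → FunClass
  | .roumieu => fun _ _ U => {f | SmoothOn f U ∧ ∀ K ⊆ U, IsCompact K → ∃ x, supNorm f K (W x) < ∞}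
  | .beurling => fun _ _ U => {f | SmoothOn f U ∧ ∀ K ⊆ U, IsCompact K → ∀ x, supNorm f K (W x) < ∞}

/-- The weights of `seqClass M`. -/
def seqFam (M : ℕ → ℝ) (h : Set.Ioi (0 : ℝ)) : ℕ → ℝ := scaled M h

/-- The weights of `matrixClass M`. -/
def matrixFam {Λ : Type} (M : Λ → ℕ → ℝ) (p : Λ × Set.Ioi (0 : ℝ)) : ℕ → ℝ :=
  scaled (M p.1) p.2

theorem seqNorm_eq {r s : ℕ} (M : ℕ → ℝ) (h : ℝ) (f : E r → E s) (K : Set (E r)) :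
    seqNorm M h f K = supNorm f K (scaled M h) := rfl

theorem seqClass_eq (M : ℕ → ℝ) (τ : ClassType) : seqClass M τ = famClass (seqFam M) τ := by
  cases τ <;> funext r s U <;> ext f <;>
    simp [seqClass, famClass, seqNorm_eq, seqFam, Subtype.exists, Subtype.forall]

theorem weightNorm_eq {r s : ℕ} (ω : ℝ → ℝ) (l : ℝ) (f : E r → E s) (K : Set (E r)) :
    weightNorm ω l f K = supNorm f K (Omega ω l) := rfl

theorem weightClass_eq (ω : ℝ → ℝ) (τ : ClassType) :
    weightClass ω τ = famClass (OmegaMatrix ω) τ := by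
  cases τ <;> funext r s U <;> ext f <;>
    simp [weightClass, famClass, weightNorm_eq, OmegaMatrix, Subtype.exists, Subtype.forall]

theorem matrixClass_eq {Λ : Type} (M : Λ → ℕ → ℝ) (τ : ClassType) :
    matrixClass M τ = famClass (matrixFam M) τ := by
  cases τ <;> funext r s U <;> ext f <;>
    simp [matrixClass, famClass, seqNorm_eq, matrixFam, Prod.exists, Prod.forall, Subtype.exists,
      Subtype.forall]

/-- Domination of families, as it corresponds to the inclusion of the classes of a given type. -/
def FamLE {Λ Λ' : Type} (W : Λ → ℕ → ℝ) (V : Λ' → ℕ → ℝ) : ClassType → Prop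
  | .roumieu => ∀ x, ∃ y, Dominated (W x) (V y)
  | .beurling => ∀ y, ∃ x, Dominated (W x) (V y)

theorem famClass_subset {Λ Λ' : Type} {W : Λ → ℕ → ℝ} {V : Λ' → ℕ → ℝ} {τ : ClassType}
    (hW : ∀ x k, 0 < W x k) (hV : ∀ x k, 0 < V x k) (h : FamLE W V τ) (r s : ℕ) (U : Set (E r)) :
    famClass W τ r s U ⊆ famClass V τ r s U := by
  cases τ with
  | roumieu =>
    rintro f ⟨hf, H⟩
    refine ⟨hf, fun K hK hc => ?_⟩
    obtain ⟨x, hx⟩ := H K hK hc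
    obtain ⟨y, hy⟩ := h x
    exact ⟨y, supNorm_lt_top_of_dominated (hW x) (hV y) hy hx⟩
  | beurling =>
    rintro f ⟨hf, H⟩
    refine ⟨hf, fun K hK hc y => ?_⟩
    obtain ⟨x, hx⟩ := h y
    exact supNorm_lt_top_of_dominated (hW x) (hV y) hx (H K hK hc x)

theorem sameClass_famClass {Λ Λ' : Type} {W : Λ → ℕ → ℝ} {V : Λ' → ℕ → ℝ} {τ : ClassType}
    (hW : ∀ x k, 0 < W x k) (hV : ∀ x k, 0 < V x k) (h : FamLE W V τ) (h' : FamLE V W τ) :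
    SameClass (famClass W τ) (famClass V τ) := fun r s _ _ U _ _ =>
  (famClass_subset hW hV h r s U).antisymm (famClass_subset hV hW h' r s U)

theorem SameClass.symm {A B : FunClass} (h : SameClass A B) : SameClass B A :=
  fun r s hr hs U hU hne => (h r s hr hs U hU hne).symm

theorem SameClass.trans {A B C : FunClass} (h : SameClass A B) (h' : SameClass B C) :
    SameClass A C :=
  fun r s hr hs U hU hne => (h r s hr hs U hU hne).trans (h' r s hr hs U hU hne)

/-- Equality of classes forces the inclusion of the corresponding sets of moment sequences. -/
theorem IsMoment.of_sameClass_roumieu {Λ Λ' : Type} {W : Λ → ℕ → ℝ} {V : Λ' → ℕ → ℝ}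
    (hW : ∀ x k, 0 < W x k) (hV : ∀ x k, 0 < V x k)
    (h : SameClass (famClass W .roumieu) (famClass V .roumieu)) {a : ℕ → ℝ} (ha : IsMoment a)
    (H : ∃ x, Dominated a (W x)) : ∃ y, Dominated a (V y) := by
  obtain ⟨f, hf, hle, h0⟩ := ha.exists_function
  obtain ⟨x, C, hC⟩ := H
  have hmem : f ∈ famClass W .roumieu 1 2 Set.univ := ⟨hf.contDiffOn, fun K _ _ =>
    ⟨x, (supNorm_lt_top_iff (hW x)).2 ⟨C, fun k z _ => (hle k z).trans (hC k)⟩⟩⟩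
  rw [h 1 2 one_pos two_pos _ isOpen_univ Set.univ_nonempty] at hmem
  obtain ⟨y, hy⟩ := hmem.2 {0} (Set.subset_univ _) isCompact_singleton
  obtain ⟨D, hD⟩ := (supNorm_lt_top_iff (hV y)).1 hy
  exact ⟨y, D, fun k => (h0 k).symm.trans_le (hD k 0 rfl)⟩

/-- The function realizing the moments is bounded globally by `a`, so it lies in the first class;
membership in the second, tested on the compact set {0}, returns the bound for `a`. -/
theorem IsMoment.of_sameClass_beurling {Λ Λ' : Type} {W : Λ → ℕ → ℝ} {V : Λ' → ℕ → ℝ}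
    (hW : ∀ x k, 0 < W x k) (hV : ∀ x k, 0 < V x k)
    (h : SameClass (famClass W .beurling) (famClass V .beurling)) {a : ℕ → ℝ} (ha : IsMoment a)
    (H : ∀ x, Dominated a (W x)) (y : Λ') : Dominated a (V y) := by
  obtain ⟨f, hf, hle, h0⟩ := ha.exists_function
  have hmem : f ∈ famClass W .beurling 1 2 Set.univ := ⟨hf.contDiffOn, fun K _ _ x => by
    obtain ⟨C, hC⟩ := H x
    exact (supNorm_lt_top_iff (hW x)).2 ⟨C, fun k z _ => (hle k z).trans (hC k)⟩⟩
  rw [h 1 2 one_pos two_pos _ isOpen_univ Set.univ_nonempty] at hmem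
  have hy := hmem.2 {0} (Set.subset_univ _) isCompact_singleton y
  obtain ⟨D, hD⟩ := (supNorm_lt_top_iff (hV y)).1 hy
  exact ⟨D, fun k => (h0 k).symm.trans_le (hD k 0 rfl)⟩

/-! ### Log-convex sequences -/

section LC

variable {M : ℕ → ℝ}

theorem IsLC.quot_pos (hM : IsLC M) (k : ℕ) : 0 < quot M k := by
  cases k with
  | zero => exact one_pos
  | succ k => exact div_pos (hM.pos _) (hM.pos _)

theorem IsLC.succ_eq (hM : IsLC M) (k : ℕ) : M (k + 1) = M k * quot M (k + 1) := by
  have := (hM.pos k).ne'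
  simp only [quot]
  field_simp

theorem IsLC.quot_mono (hM : IsLC M) : Monotone (quot M) := by
  refine monotone_nat_of_le_succ fun k => ?_
  cases k with
  | zero => simpa [quot, hM.zero_eq_one] using hM.one_le
  | succ k =>
    simp only [quot]
    rw [div_le_div_iff₀ (hM.pos _) (hM.pos _)]
    nlinarith [hM.logConvex k]

theorem IsLC.one_le_quot (hM : IsLC M) (k : ℕ) : 1 ≤ quot M k := hM.quot_mono (Nat.zero_le k)

theorem IsLC.mono (hM : IsLC M) : Monotone M := by
  refine monotone_nat_of_le_succ fun k => ?_
  rw [hM.succ_eq]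
  exact le_mul_of_one_le_right (hM.pos k).le (hM.one_le_quot _)

theorem IsLC.one_le_apply (hM : IsLC M) (k : ℕ) : 1 ≤ M k :=
  hM.zero_eq_one ▸ hM.mono (Nat.zero_le k)

/-- The function `k ↦ μ_j^k / M_k` attains its maximum at `k = j`. -/
theorem IsLC.mul_quot_pow_le (hM : IsLC M) (j k : ℕ) :
    M j * quot M j ^ k ≤ M k * quot M j ^ j := by
  have hq := hM.quot_pos j
  rcases le_total j k with h | h
  · induction k, h using Nat.le_induction with
    | base => exact le_rfl
    | succ k hk ih =>
      calc M j * quot M j ^ (k + 1) = M j * quot M j ^ k * quot M j := by ring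
        _ ≤ M k * quot M j ^ j * quot M (k + 1) := by
          have := hM.pos k
          have := hM.pos j
          gcongr
          exact hM.quot_mono (by omega)
        _ = M (k + 1) * quot M j ^ j := by rw [hM.succ_eq]; ring
  -- The ratio is frozen as ν so that it does not move with the index during the induction from k up
  -- to j.
  · have key : ∀ ν : ℝ, 0 ≤ ν → quot M j ≤ ν → ∀ i, k ≤ i → i ≤ j → M i * ν ^ k ≤ M k * ν ^ i := by
      intro ν hν hqν i hi
      induction i, hi using Nat.le_induction with
      | base => exact fun _ => le_rfl
      | succ i hi ih =>
        intro hij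
        calc M (i + 1) * ν ^ k = M i * ν ^ k * quot M (i + 1) := by rw [hM.succ_eq]; ring
          _ ≤ M k * ν ^ i * ν :=
            mul_le_mul (ih (by omega)) ((hM.quot_mono hij).trans hqν) (hM.quot_pos _).le
              (mul_nonneg (hM.pos k).le (pow_nonneg hν i))
          _ = M k * ν ^ (i + 1) := by ring
    exact key _ hq.le le_rfl j h le_rfl

theorem IsLC.exists_pow_le (hM : IsLC M) {s : ℝ} (hs : 0 ≤ s) : Dominated (fun k => s ^ k) M := by
  have h : ∀ᶠ p : ℕ in atTop, s ^ p / M p ≤ 1 := by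
    filter_upwards [hM.root_tendsto.eventually_ge_atTop s, eventually_ge_atTop 1] with p hp hp1
    refine (div_le_one (hM.pos p)).2 ?_
    calc s ^ p ≤ (M p ^ (1 / (p : ℝ))) ^ p := by gcongr
      _ = M p := by rw [one_div]; exact Real.rpow_inv_natCast_pow (hM.pos p).le (by omega)
  obtain ⟨C, hC⟩ := (isBoundedUnder_of_eventually_le h).bddAbove_range
  exact ⟨C, fun k => (div_le_iff₀ (hM.pos k)).1 (hC ⟨k, rfl⟩)⟩

/-- For each log-convex sequence `M` there is a moment sequence equivalent to `M`. -/
theorem IsLC.exists_moment (hM : IsLC M) :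
    ∃ a, IsMoment a ∧ (∀ k, M k ≤ a k) ∧ Dominated a (scaled M 2) := by
  -- The j-th atom contributes exactly M_j to the j-th moment. By log-convexity it contributes at
  -- most 2^{k-j} M_k to the k-th, where the factor 2 in the position of the atom makes the series
  -- converge.
  let c : ℕ → ℝ := fun j => M j / (2 * quot M j) ^ j
  let t : ℕ → ℝ := fun j => 2 * quot M j
  have ht : ∀ j, 0 < t j := fun j => mul_pos two_pos (hM.quot_pos j)
  have hc : ∀ j, 0 < c j := fun j => div_pos (hM.pos j) (pow_pos (ht j) j)
  have hle : ∀ k j, c j * t j ^ k ≤ 2 ^ k * M k * (1 / 2) ^ j := fun k j => by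
    have h1 := hM.mul_quot_pow_le j k
    have h2 := pow_pos (hM.quot_pos j) j
    simp only [c, t]
    rw [div_mul_eq_mul_div, div_le_iff₀ (pow_pos (ht j) j), mul_pow, mul_pow]
    calc M j * (2 ^ k * quot M j ^ k) = 2 ^ k * (M j * quot M j ^ k) := by ring
      _ ≤ 2 ^ k * (M k * quot M j ^ j) := by gcongr
      _ = 2 ^ k * M k * (1 / 2) ^ j * (2 ^ j * quot M j ^ j) := by
        rw [one_div, inv_pow]; field_simp
  have hgeo : ∀ k, HasSum (fun j : ℕ => 2 ^ k * M k * (1 / 2) ^ j) (2 ^ k * M k * 2) :=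
    fun k => hasSum_geometric_two.mul_left _
  have hnn : ∀ k j, 0 ≤ c j * t j ^ k := fun k j =>
    mul_nonneg (hc j).le (pow_nonneg (ht j).le k)
  have hs : ∀ k, Summable fun j => c j * t j ^ k := fun k =>
    Summable.of_nonneg_of_le (hnn k) (hle k) (hgeo k).summable
  refine ⟨fun k => ∑' j, c j * t j ^ k, ⟨c, t, fun j => (hc j).le, fun j => (ht j).le,
    fun k => (hs k).hasSum⟩, fun k => ?_, 2, fun k => ?_⟩
  · have h1 : c k * t k ^ k = M k := div_mul_cancel₀ _ (pow_pos (ht k) k).ne'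
    exact h1.symm.trans_le ((hs k).le_tsum k fun j _ => hnn k j)
  · refine ((hs k).tsum_le_tsum (hle k) (hgeo k).summable).trans_eq ?_
    rw [(hgeo k).tsum_eq, scaled]
    ring

/-- If each moment sequence dominated by all `h^k M^n_k` is dominated by `N`, then `M^n ≼ N` for
some `n`. -/
theorem exists_seqLE_of_moments {M : ℕ → ℕ → ℝ} (hM : ∀ n, IsLC (M n))
    (hanti : ∀ k, Antitone fun n => M n k) {N : ℕ → ℝ} (hN : ∀ k, 0 < N k)
    (H : ∀ a, IsMoment a → (∀ n, ∀ h : ℝ, 0 < h → Dominated a (scaled (M n) h)) → Dominated a N) :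
    ∃ n, SeqLE (M n) N := by
  by_contra! hcon
  have hA : ∀ n : ℕ, (1 : ℝ) ≤ n + 1 := fun n => by linarith [n.cast_nonneg (α := ℝ)]
  have hA0 : ∀ n : ℕ, (0 : ℝ) < n + 1 := fun n => by linarith [hA n]
  -- The factor 2^n will pay for summability, (n+1)^k for smallness against every h^k, and the
  -- remaining n+1 gives the contradiction.
  have hex : ∀ n : ℕ, ∃ k, ((n + 1) * 2 ^ n) * (n + 1 : ℝ) ^ k * N k < M n k := fun n => by
    by_contra! h
    exact hcon n ⟨n + 1, (n + 1) * 2 ^ n, hA n,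
      one_le_mul_of_one_le_of_one_le (hA n) (one_le_pow₀ one_le_two), h⟩
  choose κ hκ using hex
  let q : ℕ → ℝ := fun n => quot (M n) (κ n)
  have hq : ∀ n, 0 < q n := fun n => (hM n).quot_pos _
  let t : ℕ → ℝ := fun n => q n / (n + 1)
  -- With these choices c_n t_n^k ≤ 2^{-n} (n+1)^{-k} M^n_k for all k, with equality at k = κ_n.
  let c : ℕ → ℝ := fun n => (1 / 2) ^ n * (M n (κ n) / q n ^ κ n)
  have ht : ∀ n, 0 < t n := fun n => div_pos (hq n) (hA0 n)
  have hc : ∀ n, 0 < c n := fun n =>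
    mul_pos (by positivity) (div_pos ((hM n).pos _) (pow_pos (hq n) _))
  have hterm : ∀ n k, c n * t n ^ k ≤ (1 / 2) ^ n * ((1 / (n + 1)) ^ k * M n k) := fun n k => by
    have h1 : M n (κ n) / q n ^ κ n * q n ^ k ≤ M n k := by
      rw [div_mul_eq_mul_div, div_le_iff₀ (pow_pos (hq n) _)]
      exact (hM n).mul_quot_pow_le _ _
    calc c n * t n ^ k
        = (1 / 2) ^ n * ((1 / (n + 1)) ^ k * (M n (κ n) / q n ^ κ n * q n ^ k)) := by
          simp only [c, t, div_pow, one_pow]; ring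
      _ ≤ _ := by have := hA0 n; gcongr
  have hnn : ∀ k j, 0 ≤ c j * t j ^ k := fun k j =>
    mul_nonneg (hc j).le (pow_nonneg (ht j).le k)
  have hB : ∀ (n₀ : ℕ) (h : ℝ), 0 < h → ∃ B : ℕ → ℝ, Summable B ∧
      ∀ n k, c n * t n ^ k ≤ B n * scaled (M n₀) h k := by
    intro n₀ h hh
    have hD : ∀ n, ∃ D : ℝ, ∀ k, (t n / h) ^ k ≤ D * M n₀ k := fun n =>
      (hM n₀).exists_pow_le (div_pos (ht n) hh).le
    choose D hD using hD
    -- From this index on, 1/(n+1) ≤ h and M^n ≤ M^{n₀}. The finitely many earlier atoms contribute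
    -- geometric sequences, which every log-convex sequence dominates.
    let n₁ := max n₀ ⌈1 / h⌉₊
    refine ⟨fun n => (1 / 2) ^ n + (if n < n₁ then c n * |D n| else 0), ?_, fun n k => ?_⟩
    · refine summable_geometric_two.add (summable_of_ne_finset_zero (s := Finset.range n₁) ?_)
      intro n hn
      rw [if_neg (by simpa using hn)]
    · have hpos : 0 < scaled (M n₀) h k := scaled_pos (hM n₀).pos hh k
      beta_reduce
      by_cases hn : n < n₁
      · rw [if_pos hn]
        have h1 : c n * t n ^ k ≤ c n * |D n| * scaled (M n₀) h k := by
          calc c n * t n ^ k = c n * (h ^ k * (t n / h) ^ k) := by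
                rw [← mul_pow, mul_div_cancel₀ _ hh.ne']
            _ ≤ c n * (h ^ k * (|D n| * M n₀ k)) := by
                have := (hc n).le
                have := ((hM n₀).pos k).le
                gcongr
                exact (hD n k).trans (by gcongr; exact le_abs_self _)
            _ = _ := by rw [scaled]; ring
        refine h1.trans ?_
        gcongr
        linarith [show (0 : ℝ) < (1 / 2) ^ n by positivity]
      · rw [if_neg hn, add_zero]
        refine (hterm n k).trans ?_
        have h1 : (1 : ℝ) / (n + 1) ≤ h := by
          rw [div_le_iff₀ (hA0 n)]
          have : 1 / h ≤ n := (Nat.le_ceil _).trans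
            (Nat.cast_le.2 ((le_max_right _ _).trans (not_lt.1 hn)))
          rw [div_le_iff₀ hh] at this
          nlinarith
        have h2 : M n k ≤ M n₀ k := hanti k ((le_max_left _ _).trans (not_lt.1 hn))
        have := hA0 n
        have := ((hM n).pos k).le
        rw [scaled]
        gcongr
  have hs : ∀ k, Summable fun j => c j * t j ^ k := fun k => by
    obtain ⟨B, hBs, hBle⟩ := hB 0 1 one_pos
    exact Summable.of_nonneg_of_le (hnn k) (fun n => hBle n k) (hBs.mul_right _)
  obtain ⟨C, hC⟩ := H (fun k => ∑' j, c j * t j ^ k)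
    ⟨c, t, fun j => (hc j).le, fun j => (ht j).le, fun k => (hs k).hasSum⟩ fun n₀ h hh => by
      obtain ⟨B, hBs, hBle⟩ := hB n₀ h hh
      refine ⟨∑' n, B n, fun k => ?_⟩
      rw [← tsum_mul_right]
      exact (hs k).tsum_le_tsum (fun n => hBle n k) (hBs.mul_right _)
  -- The n-th atom alone makes the κ_n-th moment exceed (n+1) N, which is impossible once n ≥ C.
  obtain ⟨n, hn⟩ := exists_nat_ge C
  have h1 : c n * t n ^ κ n ≤ C * N (κ n) :=
    ((hs (κ n)).le_tsum n fun j _ => hnn (κ n) j).trans (hC (κ n))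
  have h2 : c n * t n ^ κ n * (2 ^ n * (n + 1) ^ κ n) = M n (κ n) := by
    have := (hq n).ne'
    have := (hA0 n).ne'
    simp only [c, t, div_pow, one_pow]
    field_simp
  have h3 : c n * t n ^ κ n * (2 ^ n * (n + 1) ^ κ n) ≤
      (n + 1) * N (κ n) * (2 ^ n * (n + 1) ^ κ n) := by
    refine mul_le_mul_of_nonneg_right (h1.trans ?_) (by have := hA0 n; positivity)
    exact mul_le_mul_of_nonneg_right (by linarith) (hN _).le
  rw [h2] at h3
  linarith [hκ n]

end LC

theorem seqFam_pos {M : ℕ → ℝ} (hM : ∀ k, 0 < M k) (h : Set.Ioi (0 : ℝ)) (k : ℕ) :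
    0 < seqFam M h k := scaled_pos hM h.2 k

/-- For log-convex `M` the equality of the classes of `M` and `N` implies `M ≼ N`. -/
theorem IsLC.seqLE_of_sameClass {M N : ℕ → ℝ} (hM : IsLC M) (hN : ∀ k, 0 < N k) {τ : ClassType}
    (h : SameClass (seqClass M τ) (seqClass N τ)) : SeqLE M N := by
  rw [seqClass_eq, seqClass_eq] at h
  cases τ with
  | roumieu =>
    obtain ⟨a, ha, hle, hdom⟩ := hM.exists_moment
    obtain ⟨y, hy⟩ := ha.of_sameClass_roumieu (seqFam_pos hM.pos) (seqFam_pos hN) h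
      ⟨⟨2, two_pos (α := ℝ)⟩, hdom⟩
    exact .of_dominated (fun k => (hN k).le) y.2
      ((Dominated.of_le hle).trans (fun k => (hM.pos k).le.trans (hle k)) hy)
  | beurling =>
    obtain ⟨_, hn⟩ := exists_seqLE_of_moments (M := fun _ => M) (fun _ => hM)
      (fun _ => antitone_const) hN fun a ha H => by
        have := ha.of_sameClass_beurling (seqFam_pos hM.pos) (seqFam_pos hN) h
          (fun x => H 0 x x.2) ⟨1, one_pos (α := ℝ)⟩
        rwa [seqFam, scaled_one] at this
    exact hn

/-- `M ≼ N` yields the inclusion of the classes of `M` and `N`. -/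
theorem SeqLE.famLE {M N : ℕ → ℝ} (h : SeqLE M N) (τ : ClassType) :
    FamLE (seqFam M) (seqFam N) τ := by
  obtain ⟨g, hg, H⟩ := h.dominated
  have key : ∀ x : ℝ, 0 < x → Dominated (scaled M x) (scaled N (x * g)) := fun x hx => by
    have := Dominated.rescale (h := 1) hx (w := scaled N g) (by rwa [scaled_one])
    rwa [mul_one, scaled_scaled] at this
  cases τ with
  | roumieu => exact fun x => ⟨⟨x * g, mul_pos x.2 hg⟩, key x x.2⟩
  | beurling =>
    refine fun y => ⟨⟨y / g, div_pos y.2 hg⟩, ?_⟩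
    have := key (y / g) (div_pos y.2 hg)
    rwa [div_mul_cancel₀ _ hg.ne'] at this

theorem SeqEquiv.sameClass {M N : ℕ → ℝ} (hM : ∀ k, 0 < M k) (hN : ∀ k, 0 < N k)
    (h : SeqEquiv M N) (τ : ClassType) : SameClass (seqClass M τ) (seqClass N τ) := by
  rw [seqClass_eq, seqClass_eq]
  exact sameClass_famClass (seqFam_pos hM) (seqFam_pos hN) (h.1.famLE τ) (h.2.famLE τ)

theorem sameClass_seqClass_iff {M N : ℕ → ℝ} (hM : IsLC M) (hN : IsLC N) (τ : ClassType) :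
    SameClass (seqClass M τ) (seqClass N τ) ↔ SeqEquiv N M :=
  ⟨fun h => ⟨hN.seqLE_of_sameClass hM.pos h.symm, hM.seqLE_of_sameClass hN.pos h⟩,
    fun h => h.symm.sameClass hM.pos hN.pos τ⟩

/-! ### The Young conjugate -/

section Young

variable {ω : ℝ → ℝ}

theorem IsW.le_young (hω : IsW ω) {x y : ℝ} (hy : 0 ≤ y) : x * y - ω (Real.exp y) ≤ young ω x :=
  le_csSup (bddAbove_young hω x) ⟨y, hy, rfl⟩

theorem young_le {x B : ℝ} (h : ∀ y, 0 ≤ y → x * y - ω (Real.exp y) ≤ B) : young ω x ≤ B := by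
  refine csSup_le (Set.nonempty_Ici.image _) ?_
  rintro _ ⟨y, hy, rfl⟩
  exact h y hy

theorem IsW.exp_of_nonpos (hω : IsW ω) {y : ℝ} (hy : y ≤ 0) : ω (Real.exp y) = 0 :=
  hω.zero_on _ ⟨(Real.exp_pos y).le, Real.exp_le_one_iff.2 hy⟩

theorem IsW.young_nonneg (hω : IsW ω) (x : ℝ) : 0 ≤ young ω x := by
  have := hω.le_young (x := x) le_rfl
  rwa [hω.exp_of_nonpos le_rfl, mul_zero, sub_zero] at this

theorem IsW.young_zero (hω : IsW ω) : young ω 0 = 0 := by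
  refine le_antisymm (young_le fun y _ => ?_) (hω.young_nonneg 0)
  linarith [hω.nonneg _ (Real.exp_pos y).le]

theorem IsW.young_mono (hω : IsW ω) : Monotone (young ω) := fun x x' h => young_le fun y hy =>
  le_trans (by gcongr) (hω.le_young hy)

theorem IsW.young_convex (hω : IsW ω) : ConvexOn ℝ Set.univ (young ω) := by
  refine ⟨convex_univ, fun x _ x' _ a b ha hb hab => young_le fun y hy => ?_⟩
  have h1 := mul_le_mul_of_nonneg_left (hω.le_young (x := x) hy) ha
  have h2 := mul_le_mul_of_nonneg_left (hω.le_young (x := x') hy) hb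
  have h3 : ω (Real.exp y) = a * ω (Real.exp y) + b * ω (Real.exp y) := by
    rw [← add_mul, hab, one_mul]
  simp only [smul_eq_mul]
  linarith

/-- The function `x ↦ φ*(x) / x` is non-decreasing. -/
theorem IsW.young_div_mono (hω : IsW ω) {x x' : ℝ} (hx : 0 < x) (h : x ≤ x') :
    young ω x / x ≤ young ω x' / x' := by
  have hx' : 0 < x' := hx.trans_le h
  have h1 := hω.young_convex.2 (Set.mem_univ x') (Set.mem_univ 0)
    (show 0 ≤ x / x' by positivity) (show 0 ≤ 1 - x / x' by rwa [sub_nonneg, div_le_one hx'])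
    (by ring)
  simp only [smul_eq_mul, mul_zero, add_zero, hω.young_zero, div_mul_cancel₀ _ hx'.ne'] at h1
  rw [div_le_iff₀ hx]
  calc young ω x ≤ x / x' * young ω x' := h1
    _ = _ := by ring

theorem IsW.exists_om1 (hω : IsW ω) : ∃ L : ℕ, 1 ≤ L ∧ ∀ t, 0 ≤ t → ω (2 * t) ≤ L * ω t + L := by
  obtain ⟨c, hc⟩ := hω.om1.bound
  obtain ⟨A, hA⟩ := eventually_atTop.1 hc
  obtain ⟨L, hL⟩ := exists_nat_ge (max c (max 1 (ω (2 * |A|))))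
  have hc' : c ≤ L := (le_max_left _ _).trans hL
  have h1 : (1 : ℝ) ≤ L := (le_max_left _ _).trans ((le_max_right _ _).trans hL)
  have h2 : ω (2 * |A|) ≤ L := (le_max_right _ _).trans ((le_max_right _ _).trans hL)
  refine ⟨L, Nat.one_le_cast.1 h1, fun t ht => ?_⟩
  have h0 := hω.nonneg t ht
  rcases le_total A t with h | h
  · have := hA t h
    rw [Real.norm_of_nonneg h0, Real.norm_of_nonneg (hω.nonneg _ (by positivity))] at this
    nlinarith
  · have h3 : ω (2 * t) ≤ ω (2 * |A|) := hω.mono (Set.mem_Ici.2 (by positivity))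
      (Set.mem_Ici.2 (by positivity)) (by linarith [le_abs_self A])
    nlinarith

/-- Testing the supremum for φ*(Lx) at y + log 2 and bounding ω(2e^y) by Lω(e^y) + L produces the
gain Lx log 2. -/
theorem IsW.exists_young_dilate (hω : IsW ω) : ∃ L : ℕ, 1 ≤ L ∧ ∀ x, 0 ≤ x →
    L * young ω x + L * x * Real.log 2 ≤ young ω (L * x) + L := by
  obtain ⟨L, hL, h⟩ := hω.exists_om1
  have hL' : (0 : ℝ) < L := Nat.cast_pos.2 hL
  refine ⟨L, hL, fun x hx => ?_⟩
  have : young ω x ≤ (young ω (L * x) + L - L * x * Real.log 2) / L := young_le fun y hy => by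
    rw [le_div_iff₀ hL']
    have h1 := hω.le_young (x := L * x) (add_nonneg hy (Real.log_nonneg one_le_two))
    rw [Real.exp_add, Real.exp_log two_pos, mul_comm (Real.exp y)] at h1
    have h2 := h _ (Real.exp_pos y).le
    linarith
  rw [le_div_iff₀ hL'] at this
  linarith

/-- Iterated form of `(ω₁)` in terms of the Young conjugate. -/
theorem IsW.exists_young_growth (hω : IsW ω) (A : ℝ) : ∃ Q : ℕ, 1 ≤ Q ∧ ∃ D, 0 ≤ D ∧ ∀ x, 0 ≤ x →
    Q * (young ω x + A * x) ≤ young ω (Q * x) + D := by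
  obtain ⟨L, hL, h⟩ := hω.exists_young_dilate
  have hL' : (0 : ℝ) < L := Nat.cast_pos.2 hL
  have key : ∀ m : ℕ, ∃ D, 0 ≤ D ∧ ∀ x, 0 ≤ x →
      (L : ℝ) ^ m * (young ω x + m * Real.log 2 * x) ≤ young ω ((L : ℝ) ^ m * x) + D := by
    intro m
    induction m with
    | zero => exact ⟨0, le_rfl, fun x _ => by simp⟩
    | succ m ih =>
      obtain ⟨D, hD, H⟩ := ih
      refine ⟨L * D + L, by positivity, fun x hx => ?_⟩
      have h1 := h ((L : ℝ) ^ m * x) (by positivity)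
      have h2 := mul_le_mul_of_nonneg_left (H x hx) hL'.le
      rw [show (L : ℝ) ^ (m + 1) * x = L * ((L : ℝ) ^ m * x) by ring]
      push_cast
      linarith [show (L : ℝ) ^ (m + 1) * (young ω x + (m + 1) * Real.log 2 * x) =
        L * ((L : ℝ) ^ m * (young ω x + m * Real.log 2 * x)) + L * ((L : ℝ) ^ m * x) * Real.log 2
        by ring]
  -- Each iteration gains log 2 in the linear term, so m of them reach A, and Q = L^m.
  obtain ⟨m, hm⟩ := exists_nat_ge (A / Real.log 2)
  rw [div_le_iff₀ (Real.log_pos one_lt_two)] at hm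
  obtain ⟨D, hD, H⟩ := key m
  refine ⟨L ^ m, Nat.one_le_pow _ _ hL, D, hD, fun x hx => ?_⟩
  push_cast
  refine le_trans ?_ (H x hx)
  gcongr

/-- An approximate converse of the definition of the Young conjugate. -/
theorem IsW.exists_young_le (hω : IsW ω) (y : ℝ) :
    ∃ x, 0 ≤ x ∧ young ω x ≤ x * y - ω (Real.exp y) + 1 := by
  have hcont : Continuous fun t : ℝ => ω (Real.exp t) :=
    continuousOn_univ.1 (hω.om4.continuousOn isOpen_univ)
  -- An affine minorant of t ↦ ω(e^t) that loses at most 1 at y; its slope is the required x.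
  obtain ⟨x, c, hle, heq⟩ := hω.om4.exists_affine_le_of_lt_real (Set.mem_univ y)
    (sub_one_lt (ω (Real.exp y))) isClosed_univ (hcont.lowerSemicontinuous.lowerSemicontinuousOn _)
  refine ⟨x, ?_, young_le fun z _ => ?_⟩
  · by_contra! hx
    -- With a negative slope the minorant would be at least 1 at this point, where ω(e^t) = 0.
    have h1 := hle (min 0 ((1 - c) / x)) trivial
    rw [hω.exp_of_nonpos (min_le_left _ _)] at h1
    have h2 := mul_le_mul_of_nonpos_left (min_le_right 0 ((1 - c) / x)) hx.le
    rw [mul_div_cancel₀ _ hx.ne] at h2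
    linarith
  · have := hle z trivial
    linarith

/-- `(ω₆)` in terms of the Young conjugate. -/
theorem IsW.exists_young_two_mul_le (hω : IsW ω) (h6 : Om6 ω) : ∃ a b : ℝ, 0 ≤ a ∧ 0 ≤ b ∧
    ∀ x, 0 ≤ x → young ω (2 * x) ≤ 2 * young ω x + a * x + b := by
  obtain ⟨H, hH, h⟩ := h6
  have hlog : 0 ≤ Real.log H := Real.log_nonneg hH
  refine ⟨2 * Real.log H, H, by positivity, by positivity, fun x hx => young_le fun y hy => ?_⟩
  rcases le_total (Real.log H) y with hy' | hy'
  · have h1 := hω.le_young (x := x) (sub_nonneg.2 hy')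
    have h2 := h _ (Real.exp_pos (y - Real.log H)).le
    rw [Real.exp_sub, Real.exp_log (by linarith), mul_div_cancel₀ _ (by linarith)] at h2
    rw [Real.exp_sub, Real.exp_log (by linarith)] at h1
    linarith
  · have h1 := hω.young_nonneg x
    have h2 := hω.nonneg _ (Real.exp_pos y).le
    nlinarith

/-- Let x be nearly optimal for y = log t and test φ*(2x) at log t + a/2. The shift contributes
exactly ax, which cancels the linear term of the hypothesis and leaves 2ω(t) ≤ ω(e^{a/2} t) + b + 2.
-/
theorem IsW.om6_of_young (hω : IsW ω) {a b : ℝ} (ha : 0 ≤ a)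
    (h : ∀ x, 0 ≤ x → young ω (2 * x) ≤ 2 * young ω x + a * x + b) : Om6 ω := by
  have hB : (0 : ℝ) ≤ max 1 (b + 2) := le_trans zero_le_one (le_max_left _ _)
  have hE : 1 ≤ Real.exp (a / 2) := Real.one_le_exp (by positivity)
  have hEH : Real.exp (a / 2) ≤ Real.exp (a / 2) + max 1 (b + 2) := by linarith
  have hbH : b + 2 ≤ Real.exp (a / 2) + max 1 (b + 2) := by
    linarith [le_max_right 1 (b + 2)]
  refine ⟨Real.exp (a / 2) + max 1 (b + 2), by linarith, fun t ht => ?_⟩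
  have hnn := hω.nonneg ((Real.exp (a / 2) + max 1 (b + 2)) * t) (by positivity)
  rcases le_total t 1 with h1 | h1
  · rw [hω.zero_on t ⟨ht, h1⟩]
    linarith
  · have hpos : 0 < t := by linarith
    obtain ⟨x, hx, hxy⟩ := hω.exists_young_le (Real.log t)
    rw [Real.exp_log hpos] at hxy
    have h2 := hω.le_young (x := 2 * x)
      (add_nonneg (Real.log_nonneg h1) (show 0 ≤ a / 2 by positivity))
    rw [Real.exp_add, Real.exp_log hpos] at h2
    have h3 := h x hx
    have h4 : ω (t * Real.exp (a / 2)) ≤ ω ((Real.exp (a / 2) + max 1 (b + 2)) * t) :=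
      hω.mono (Set.mem_Ici.2 (by positivity)) (Set.mem_Ici.2 (by positivity))
        (by rw [mul_comm]; gcongr)
    linarith

/-! ### The associated weight matrix -/

theorem Omega_pos (ω : ℝ → ℝ) (l : ℝ) (j : ℕ) : 0 < Omega ω l j := Real.exp_pos _

theorem log_Omega (ω : ℝ → ℝ) (l : ℝ) (j : ℕ) : Real.log (Omega ω l j) = young ω (l * j) / l := by
  rw [Omega, Real.log_exp, one_div, inv_mul_eq_div]

theorem Omega_eq (ω : ℝ → ℝ) (l : ℝ) (j : ℕ) : Omega ω l j = Real.exp (young ω (l * j) / l) := by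
  rw [Omega, one_div, inv_mul_eq_div]

theorem IsW.isLC_Omega (hω : IsW ω) {l : ℝ} (hl : 0 < l) : IsLC (Omega ω l) where
  pos := Omega_pos ω l
  zero_eq_one := by simp [Omega, hω.young_zero]
  one_le := Real.one_le_exp (mul_nonneg (by positivity) (hω.young_nonneg _))
  logConvex j := by
    simp only [Omega_eq]
    rw [sq, ← Real.exp_add, ← Real.exp_add, Real.exp_le_exp, ← add_div, ← add_div]
    refine div_le_div_of_nonneg_right ?_ hl.le
    have := hω.young_convex.2 (Set.mem_univ (l * (j : ℕ))) (Set.mem_univ (l * (j + 2 : ℕ)))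
      one_half_pos.le one_half_pos.le (by norm_num)
    simp only [smul_eq_mul] at this
    rw [show 1 / 2 * (l * (j : ℕ)) + 1 / 2 * (l * (j + 2 : ℕ)) = l * (j + 1 : ℕ) by
      push_cast; ring] at this
    linarith
  root_tendsto := by
    refine tendsto_atTop.2 fun b => ?_
    -- The extra 1 pays for the term ω(e^y)/(lj), which is at most 1 for large j.
    let y := |b| + 1
    have hy : 0 ≤ y := by positivity
    obtain ⟨n, hn⟩ := exists_nat_ge (ω (Real.exp y) / l)
    filter_upwards [eventually_ge_atTop (max 1 n)] with j hj
    have hj1 : (1 : ℝ) ≤ j := Nat.one_le_cast.2 ((le_max_left _ _).trans hj)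
    have hjn : (n : ℝ) ≤ j := Nat.cast_le.2 ((le_max_right _ _).trans hj)
    have h1 := hω.le_young (x := l * j) hy
    have h2 : ω (Real.exp y) ≤ l * j := by
      rw [div_le_iff₀ hl] at hn
      nlinarith
    rw [Omega_eq, ← Real.exp_mul]
    refine le_trans ?_ (Real.add_one_le_exp _)
    have h3 : |b| ≤ young ω (l * j) / l * (1 / j) := by
      rw [mul_one_div, div_div, le_div_iff₀ (by positivity)]
      simp only [y] at h1 h2
      linarith
    linarith [le_abs_self b]

theorem IsW.Omega_mono (hω : IsW ω) {l l' : ℝ} (hl : 0 < l) (h : l ≤ l') (j : ℕ) :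
    Omega ω l j ≤ Omega ω l' j := by
  rw [Omega_eq, Omega_eq, Real.exp_le_exp]
  rcases Nat.eq_zero_or_pos j with rfl | hj
  · simp [hω.young_zero]
  · have hj' : (0 : ℝ) < j := Nat.cast_pos.2 hj
    have := hω.young_div_mono (mul_pos hl hj') (show l * j ≤ l' * j by gcongr)
    rwa [← div_div, ← div_div, div_le_div_iff_of_pos_right hj'] at this

/-- Powers `h^k` are absorbed by passing from `Ω^l` to `Ω^{Ql}`. -/
theorem IsW.exists_dominated_Omega (hω : IsW ω) {h : ℝ} (hh : 0 < h) : ∃ Q : ℝ, 1 ≤ Q ∧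
    ∀ l : ℝ, 0 < l → Dominated (scaled (Omega ω l) h) (Omega ω (Q * l)) := by
  obtain ⟨Q, hQ, D, _, H⟩ := hω.exists_young_growth (Real.log h)
  have hQ' : (0 : ℝ) < Q := Nat.cast_pos.2 hQ
  refine ⟨Q, Nat.one_le_cast.2 hQ, fun l hl => ⟨Real.exp (D / (Q * l)), fun k => ?_⟩⟩
  rw [scaled, Omega_eq, Omega_eq, ← Real.exp_add, ← Real.exp_log (pow_pos hh k), ← Real.exp_add,
    Real.exp_le_exp, Real.log_pow, ← add_div, le_div_iff₀ (mul_pos hQ' hl), mul_assoc (Q : ℝ)]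
  have h1 := H (l * k) (by positivity)
  have h2 : (k * Real.log h + young ω (l * k) / l) * (Q * l) =
      Q * (young ω (l * k) + Real.log h * (l * k)) := by
    field_simp
    ring
  rw [h2]
  linarith

end Young

/-! ### Relations between sequences in logarithmic form -/

theorem seqLE_iff_log {M N : ℕ → ℝ} (hM : ∀ k, 0 < M k) (hN : ∀ k, 0 < N k) :
    SeqLE M N ↔ ∃ a b : ℝ, 0 ≤ a ∧ 0 ≤ b ∧ ∀ k, Real.log (M k) ≤ Real.log (N k) + a * k + b := by
  constructor
  · rintro ⟨C₁, C₂, h₁, h₂, h⟩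
    refine ⟨Real.log C₁, Real.log C₂, Real.log_nonneg h₁, Real.log_nonneg h₂, fun k => ?_⟩
    have h₁' : 0 < C₁ ^ k := by positivity
    have h₂' : 0 < C₂ := by positivity
    have := Real.log_le_log (hM k) (h k)
    rw [Real.log_mul (by positivity) (hN k).ne', Real.log_mul h₂'.ne' h₁'.ne', Real.log_pow] at this
    linarith
  · rintro ⟨a, b, ha, hb, h⟩
    refine ⟨Real.exp a, Real.exp b, Real.one_le_exp ha, Real.one_le_exp hb, fun k => ?_⟩
    have := Real.exp_le_exp.2 (h k)
    rw [Real.exp_add, Real.exp_add, Real.exp_log (hM k), Real.exp_log (hN k), mul_comm a,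
      Real.exp_nat_mul] at this
    linarith

theorem ModerateGrowth.exists_log {M : ℕ → ℝ} (hM : ∀ k, 0 < M k) (h : ModerateGrowth M) :
    ∃ a : ℝ, 0 ≤ a ∧ ∀ j k : ℕ,
      Real.log (M (j + k)) ≤ Real.log (M j) + Real.log (M k) + a * (j + k) := by
  obtain ⟨C, hC, h⟩ := h
  refine ⟨Real.log C, Real.log_nonneg hC, fun j k => ?_⟩
  have h1 : 0 < C ^ (j + k) := by positivity
  have := Real.log_le_log (hM _) (h j k)
  rw [Real.log_mul (mul_pos h1 (hM j)).ne' (hM k).ne', Real.log_mul h1.ne' (hM j).ne',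
    Real.log_pow] at this
  push_cast at this
  linarith

/-- The additive constant b fits into the exponential factor because j + k ≥ 1 unless both indices
vanish, and then M_0 = 1 settles the case. -/
theorem IsLC.moderateGrowth_of_log {M : ℕ → ℝ} (hM : IsLC M) {a b : ℝ} (ha : 0 ≤ a) (hb : 0 ≤ b)
    (h : ∀ j k : ℕ,
      Real.log (M (j + k)) ≤ Real.log (M j) + Real.log (M k) + a * (j + k) + b) :
    ModerateGrowth M := by
  refine ⟨Real.exp (a + b), Real.one_le_exp (add_nonneg ha hb), fun j k => ?_⟩
  rcases Nat.eq_zero_or_pos (j + k) with h0 | h0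
  · obtain ⟨rfl, rfl⟩ := Nat.add_eq_zero_iff.1 h0
    simp [hM.zero_eq_one]
  · have h1 : (1 : ℝ) ≤ j + k := by exact_mod_cast h0
    rw [← Real.log_le_log_iff (hM.pos _) (mul_pos (mul_pos (by positivity) (hM.pos j)) (hM.pos k)),
      Real.log_mul (mul_pos (by positivity) (hM.pos j)).ne' (hM.pos k).ne',
      Real.log_mul (by positivity) (hM.pos j).ne', Real.log_pow, Real.log_exp]
    push_cast
    nlinarith [h j k]

theorem ModerateGrowth.of_seqEquiv {M N : ℕ → ℝ} (hM : IsLC M) (hN : IsLC N)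
    (h : SeqEquiv N M) (hmg : ModerateGrowth M) : ModerateGrowth N := by
  obtain ⟨c, hc, hM'⟩ := hmg.exists_log hM.pos
  obtain ⟨a, b, ha, hb, h1⟩ := (seqLE_iff_log hN.pos hM.pos).1 h.1
  obtain ⟨a', b', ha', hb', h2⟩ := (seqLE_iff_log hM.pos hN.pos).1 h.2
  refine hN.moderateGrowth_of_log (a := a + a' + c) (b := b + 2 * b') (by positivity)
    (by positivity) fun j k => ?_
  have := h1 (j + k)
  push_cast at this
  linarith [hM' j k, h2 j, h2 k]

/-! ### The matrix `Ω` under `(ω₆)` -/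

section Matrix

variable {ω : ℝ → ℝ}

theorem IsW.seqLE_Omega_two_mul (hω : IsW ω) (h6 : Om6 ω) {l : ℝ} (hl : 0 < l) :
    SeqLE (Omega ω (2 * l)) (Omega ω l) := by
  obtain ⟨a, b, ha, hb, h⟩ := hω.exists_young_two_mul_le h6
  refine (seqLE_iff_log (Omega_pos _ _) (Omega_pos _ _)).2
    ⟨a / 2, b / (2 * l), by positivity, by positivity, fun k => ?_⟩
  rw [log_Omega, log_Omega, div_le_iff₀ (by positivity)]
  have := h (l * k) (by positivity)
  rw [← mul_assoc] at this
  refine this.trans_eq ?_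
  field_simp

theorem SeqLE.of_le {M N : ℕ → ℝ} (h : ∀ k, M k ≤ N k) : SeqLE M N :=
  ⟨1, 1, le_rfl, le_rfl, fun p => by simpa using h p⟩

theorem IsW.seqLE_Omega (hω : IsW ω) (h6 : Om6 ω) {l l' : ℝ} (hl : 0 < l) (hl' : 0 < l') :
    SeqLE (Omega ω l') (Omega ω l) := by
  have key : ∀ m : ℕ, SeqLE (Omega ω (2 ^ m * l)) (Omega ω l) := by
    intro m
    induction m with
    | zero => exact .of_le fun k => by simp
    | succ m ih =>
      rw [pow_succ', mul_assoc]
      exact (hω.seqLE_Omega_two_mul h6 (by positivity)).trans ih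
  obtain ⟨m, hm⟩ := pow_unbounded_of_one_lt (l' / l) one_lt_two
  rw [div_lt_iff₀ hl] at hm
  exact (SeqLE.of_le (hω.Omega_mono hl' hm.le)).trans (key m)

theorem IsW.seqEquiv_Omega (hω : IsW ω) (h6 : Om6 ω) {l l' : ℝ} (hl : 0 < l) (hl' : 0 < l') :
    SeqEquiv (Omega ω l) (Omega ω l') :=
  ⟨hω.seqLE_Omega h6 hl' hl, hω.seqLE_Omega h6 hl hl'⟩

/-- Convexity bounds φ*(l(j+k)) by the mean of φ*(2lj) and φ*(2lk), and (ω₆) removes the factors 2.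
-/
theorem IsW.moderateGrowth_Omega (hω : IsW ω) (h6 : Om6 ω) {l : ℝ} (hl : 0 < l) :
    ModerateGrowth (Omega ω l) := by
  obtain ⟨a, b, ha, hb, h⟩ := hω.exists_young_two_mul_le h6
  refine (hω.isLC_Omega hl).moderateGrowth_of_log (a := a / 2) (b := b / l) (by positivity)
    (by positivity) fun j k => ?_
  simp only [log_Omega]
  have h1 := hω.young_convex.2 (Set.mem_univ (2 * (l * j))) (Set.mem_univ (2 * (l * k)))
    one_half_pos.le one_half_pos.le (by norm_num)
  simp only [smul_eq_mul] at h1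
  rw [show 1 / 2 * (2 * (l * j)) + 1 / 2 * (2 * (l * k)) = l * ((j + k : ℕ) : ℝ) by
    push_cast; ring] at h1
  have h2 := h (l * j) (by positivity)
  have h3 := h (l * k) (by positivity)
  rw [div_le_iff₀ hl]
  have h4 : (young ω (l * j) / l + young ω (l * k) / l + a / 2 * (j + k) + b / l) * l =
      young ω (l * j) + young ω (l * k) + a / 2 * (l * j + l * k) + b := by
    field_simp
  rw [h4]
  linarith

/-- The hypothesis controls φ* only on multiples of l. For x ≥ l and k = ⌊x/l⌋ one has lk ≤ x and 2x
≤ 4lk, so monotonicity of φ*(x)/x transfers the bound to real x; the factor 4 instead of 2 leaves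
room for this rounding. -/
theorem IsW.om6_of_seqLE (hω : IsW ω) {l : ℝ} (hl : 0 < l)
    (h : SeqLE (Omega ω (4 * l)) (Omega ω l)) : Om6 ω := by
  obtain ⟨a, b, ha, hb, h⟩ := (seqLE_iff_log (Omega_pos _ _) (Omega_pos _ _)).1 h
  refine hω.om6_of_young (a := 2 * (a + b)) (b := young ω (2 * l)) (by positivity)
    fun x hx => ?_
  rcases lt_or_ge x l with hxl | hxl
  · have h1 := hω.young_mono (show 2 * x ≤ 2 * l by linarith)
    have h2 := hω.young_nonneg x
    have : 0 ≤ 2 * (a + b) * x := by positivity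
    linarith
  · have hx0 : 0 < x := hl.trans_le hxl
    let k := ⌊x / l⌋₊
    have hk : 1 ≤ k := Nat.le_floor (by rwa [Nat.cast_one, one_le_div hl])
    have hk' : (1 : ℝ) ≤ k := Nat.one_le_cast.2 hk
    have hk0 : (0 : ℝ) < k := by linarith
    have h1 : l * k ≤ x := by
      have := Nat.floor_le (show 0 ≤ x / l by positivity)
      rwa [le_div_iff₀ hl, mul_comm] at this
    have h2 : x ≤ 2 * (l * k) := by
      have := (Nat.lt_floor_add_one (x / l)).le
      rw [div_le_iff₀ hl] at this
      simp only [k] at hk' ⊢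
      nlinarith
    have h3 := hω.young_div_mono (show 0 < 2 * x by positivity)
      (show 2 * x ≤ 4 * l * k by linarith)
    have h4 := hω.young_div_mono (show 0 < l * k by positivity) h1
    have h5 := h k
    rw [log_Omega, log_Omega] at h5
    have h6 : young ω (4 * l * k) / (4 * l * k) ≤ young ω (l * k) / (l * k) + (a + b) := by
      rw [← div_div _ (4 * l), ← div_div _ l, div_le_iff₀ hk0, add_mul, div_mul_cancel₀ _ hk0.ne']
      nlinarith
    have h7 : young ω (2 * x) / (2 * x) ≤ young ω x / x + (a + b) := by linarith
    rw [div_le_iff₀ (by positivity)] at h7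
    have h8 : (young ω x / x + (a + b)) * (2 * x) = 2 * young ω x + 2 * (a + b) * x := by
      field_simp
    linarith [hω.young_nonneg (2 * l)]

theorem OmegaMatrix_pos (ω : ℝ → ℝ) (l : Set.Ioi (0 : ℝ)) (k : ℕ) : 0 < OmegaMatrix ω l k :=
  Omega_pos ω l k

theorem matrixFam_OmegaMatrix_pos (ω : ℝ → ℝ) (p : Set.Ioi (0 : ℝ) × Set.Ioi (0 : ℝ)) (k : ℕ) :
    0 < matrixFam (OmegaMatrix ω) p k := scaled_pos (Omega_pos ω p.1) p.2.2 k

theorem IsW.exists_dominated_scaled_Omega (hω : IsW ω) {h : ℝ} (hh : 0 < h) : ∃ Q : ℝ, 1 ≤ Q ∧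
    ∀ l : ℝ, 0 < l → Dominated (Omega ω (l / Q)) (scaled (Omega ω l) h) := by
  obtain ⟨Q, hQ, H⟩ := hω.exists_dominated_Omega (inv_pos.2 hh)
  have hQ' : 0 < Q := by linarith
  refine ⟨Q, hQ, fun l hl => ?_⟩
  have := (H (l / Q) (by positivity)).rescale hh
  rwa [mul_inv_cancel₀ hh.ne', scaled_one, mul_div_cancel₀ _ hQ'.ne'] at this

/-- The parameter h is redundant by (ω₁): l is enlarged in the Roumieu case and reduced in the
Beurling case. -/
theorem IsW.sameClass_weight_matrix (hω : IsW ω) (τ : ClassType) :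
    SameClass (weightClass ω τ) (matrixClass (OmegaMatrix ω) τ) := by
  rw [weightClass_eq, matrixClass_eq]
  have h1 : ∀ l : Set.Ioi (0 : ℝ),
      matrixFam (OmegaMatrix ω) (l, ⟨1, one_pos (α := ℝ)⟩) = OmegaMatrix ω l := fun l =>
    scaled_one _
  refine sameClass_famClass (OmegaMatrix_pos ω) (matrixFam_OmegaMatrix_pos ω) ?_ ?_
  · cases τ with
    | roumieu => exact fun l => ⟨(l, ⟨1, one_pos (α := ℝ)⟩), .of_le fun k => by rw [h1]⟩
    | beurling =>
      rintro ⟨l, h⟩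
      obtain ⟨Q, hQ, H⟩ := hω.exists_dominated_scaled_Omega h.2
      exact ⟨⟨l / Q, div_pos l.2 (zero_lt_one.trans_le hQ)⟩, H l l.2⟩
  · cases τ with
    | roumieu =>
      rintro ⟨l, h⟩
      obtain ⟨Q, hQ, H⟩ := hω.exists_dominated_Omega h.2
      exact ⟨⟨Q * l, mul_pos (zero_lt_one.trans_le hQ) l.2⟩, H l l.2⟩
    | beurling => exact fun l => ⟨(l, ⟨1, one_pos (α := ℝ)⟩), .of_le fun k => by rw [h1]⟩

/-- The parameters h and l are interchangeable: (ω₁) trades h^k for a change of l, and (ω₆) trades a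
change of l for h^k. -/
theorem IsW.sameClass_Omega_weight (hω : IsW ω) (h6 : Om6 ω) {l : ℝ} (hl : 0 < l) (τ : ClassType) :
    SameClass (seqClass (Omega ω l) τ) (weightClass ω τ) := by
  rw [weightClass_eq, seqClass_eq]
  refine sameClass_famClass (seqFam_pos (Omega_pos ω l)) (OmegaMatrix_pos ω) ?_ ?_
  · cases τ with
    | roumieu =>
      intro h
      obtain ⟨Q, hQ, H⟩ := hω.exists_dominated_Omega h.2
      exact ⟨⟨Q * l, mul_pos (by linarith) hl⟩, H l hl⟩
    | beurling =>
      intro l'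
      obtain ⟨g, hg, H⟩ := (hω.seqLE_Omega h6 l'.2 hl).dominated
      refine ⟨⟨g⁻¹, inv_pos.2 hg⟩, ?_⟩
      have := Dominated.rescale (a := Omega ω l) (h := 1) (inv_pos.2 hg) (by rwa [scaled_one])
      rwa [mul_one, scaled_scaled, inv_mul_cancel₀ hg.ne', scaled_one] at this
  · cases τ with
    | roumieu =>
      intro l'
      obtain ⟨g, hg, H⟩ := (hω.seqLE_Omega h6 hl l'.2).dominated
      exact ⟨⟨g, hg⟩, H⟩
    | beurling =>
      intro h
      obtain ⟨Q, hQ, H⟩ := hω.exists_dominated_scaled_Omega h.2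
      exact ⟨⟨l / Q, div_pos hl (by linarith)⟩, H l hl⟩

/-- If the class of `ω` is the class of a log-convex sequence `N`, then `ω` has `(ω₆)`. -/
theorem IsW.om6_of_sameClass (hω : IsW ω) {N : ℕ → ℝ} (hN : IsLC N) {τ : ClassType}
    (h : SameClass (seqClass N τ) (weightClass ω τ)) :
    Om6 ω ∧ ∀ l : ℝ, 0 < l → SeqEquiv N (Omega ω l) := by
  rw [weightClass_eq, seqClass_eq] at h
  suffices H : ∃ l l' : ℝ, 0 < l ∧ 0 < l' ∧ SeqLE N (Omega ω l) ∧ SeqLE (Omega ω (4 * l)) N ∧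
      SeqLE (Omega ω l') N by
    obtain ⟨l, l', hl, hl', h1, h2, h3⟩ := H
    have h6 := hω.om6_of_seqLE hl (h2.trans h1)
    exact ⟨h6, fun k hk => ⟨h1.trans (hω.seqLE_Omega h6 hk hl),
      (hω.seqLE_Omega h6 hl' hk).trans h3⟩⟩
  cases τ with
  | roumieu =>
    have h1 : ∃ l : ℝ, 0 < l ∧ SeqLE N (Omega ω l) := by
      obtain ⟨a, ha, hle, hdom⟩ := hN.exists_moment
      obtain ⟨l, hl⟩ := ha.of_sameClass_roumieu (seqFam_pos hN.pos) (OmegaMatrix_pos ω) h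
        ⟨⟨2, two_pos (α := ℝ)⟩, hdom⟩
      refine ⟨l, l.2, .of_dominated (fun k => (Omega_pos ω l k).le) one_pos ?_⟩
      rw [scaled_one]
      exact (Dominated.of_le hle).trans (fun k => (hN.pos k).le.trans (hle k)) hl
    have h2 : ∀ l : ℝ, 0 < l → SeqLE (Omega ω l) N := fun l hl => by
      obtain ⟨a, ha, hle, hdom⟩ := (hω.isLC_Omega hl).exists_moment
      -- The moment sequence equivalent to Ω^l is only bounded by 2^k Ω^l_k; passing to Ω^{Ql} puts
      -- it under a weight of the family.
      obtain ⟨Q, hQ, H⟩ := hω.exists_dominated_Omega (two_pos (α := ℝ))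
      obtain ⟨g, hg⟩ := ha.of_sameClass_roumieu (OmegaMatrix_pos ω) (seqFam_pos hN.pos) h.symm
        ⟨⟨Q * l, mul_pos (by linarith) hl⟩,
          hdom.trans (fun k => (scaled_pos (Omega_pos ω l) two_pos k).le) (H l hl)⟩
      exact .of_dominated (fun k => (hN.pos k).le) g.2
        ((Dominated.of_le hle).trans (fun k => (Omega_pos ω l k).le.trans (hle k)) hg)
    obtain ⟨l, hl, h1⟩ := h1
    exact ⟨l, l, hl, hl, h1, h2 _ (by positivity), h2 l hl⟩
  | beurling =>
    have h1 : ∀ l : ℝ, 0 < l → SeqLE N (Omega ω l) := fun l hl => by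
      obtain ⟨_, hn⟩ := exists_seqLE_of_moments (M := fun _ => N) (fun _ => hN)
        (fun _ => antitone_const) (Omega_pos ω l) fun a ha H =>
          ha.of_sameClass_beurling (seqFam_pos hN.pos) (OmegaMatrix_pos ω) h
            (fun x => H 0 x x.2) ⟨l, hl⟩
      exact hn
    have hn0 : ∀ n : ℕ, (0 : ℝ) < 1 / (n + 1) := fun n => Nat.one_div_pos_of_nat
    have h2 : ∃ l : ℝ, 0 < l ∧ SeqLE (Omega ω l) N := by
      -- The sequences Ω^{1/(n+1)} decrease in n and eventually lie below any given Ω^l, so they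
      -- describe the whole Beurling family.
      obtain ⟨n, hn⟩ := exists_seqLE_of_moments (M := fun n => Omega ω (1 / (n + 1)))
        (fun n => hω.isLC_Omega (hn0 n))
        (fun k m n hmn => hω.Omega_mono (hn0 n) (Nat.one_div_le_one_div hmn) k) hN.pos
        fun a ha H => by
          have := ha.of_sameClass_beurling (OmegaMatrix_pos ω) (seqFam_pos hN.pos) h.symm
            (fun l => by
              obtain ⟨n, hn⟩ := exists_nat_one_div_lt (Set.mem_Ioi.1 l.2)
              have h3 := H n 1 one_pos
              rw [scaled_one] at h3
              exact h3.trans (fun k => (Omega_pos _ _ k).le)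
                (.of_le (hω.Omega_mono (hn0 n) hn.le))) ⟨1, one_pos (α := ℝ)⟩
          rwa [seqFam, scaled_one] at this
      exact ⟨_, hn0 n, hn⟩
    obtain ⟨l, hl, h2⟩ := h2
    refine ⟨l / 4, l, by positivity, hl, h1 _ (by positivity), ?_, h2⟩
    rwa [mul_div_cancel₀ _ four_ne_zero]

end Matrix

/-! ### Growth of sequences and their associated functions -/

/-- The growth of a sequence that corresponds to `(ω₁)` for its associated function. -/
def StrongGrowth (N : ℕ → ℝ) : Prop := ∀ A : ℝ, ∃ Q : ℕ, 1 ≤ Q ∧ ∃ D : ℝ, 0 ≤ D ∧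
  ∀ j : ℕ, Q * (Real.log (N j) + A * j) ≤ Real.log (N (Q * j)) + D

theorem IsW.strongGrowth {ω : ℝ → ℝ} (hω : IsW ω) {N : ℕ → ℝ} (hN : ∀ k, 0 < N k)
    (h : SeqEquiv N (Omega ω 1)) : StrongGrowth N := by
  obtain ⟨a, b, ha, hb, h1⟩ := (seqLE_iff_log hN (Omega_pos ω 1)).1 h.1
  obtain ⟨a', b', ha', hb', h2⟩ := (seqLE_iff_log (Omega_pos ω 1) hN).1 h.2
  intro A
  -- The surplus a + a' compensates the exponential factors lost in passing from N to Ω^1 and back.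
  obtain ⟨Q, hQ, D, hD, H⟩ := hω.exists_young_growth (A + a + a')
  refine ⟨Q, hQ, D + Q * b + b', by positivity, fun j => ?_⟩
  have h3 := H j (by positivity)
  have h4 := mul_le_mul_of_nonneg_left (h1 j) (Nat.cast_nonneg (α := ℝ) Q)
  have h5 := h2 (Q * j)
  rw [log_Omega] at h4 h5
  simp only [one_mul, div_one, Nat.cast_mul] at h4 h5
  linarith

section LC

variable {N : ℕ → ℝ}

theorem IsLC.log_nonneg (hN : IsLC N) (k : ℕ) : 0 ≤ Real.log (N k) :=
  Real.log_nonneg (hN.one_le_apply k)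

theorem IsLC.log_mul_quot_pow_le (hN : IsLC N) (j k : ℕ) :
    Real.log (N j) + k * Real.log (quot N j) ≤ Real.log (N k) + j * Real.log (quot N j) := by
  have hq := hN.quot_pos j
  have := Real.log_le_log (mul_pos (hN.pos j) (pow_pos hq k)) (hN.mul_quot_pow_le j k)
  rwa [Real.log_mul (hN.pos j).ne' (pow_pos hq k).ne',
    Real.log_mul (hN.pos k).ne' (pow_pos hq j).ne', Real.log_pow, Real.log_pow] at this

theorem IsLC.log_le_mul_log_quot (hN : IsLC N) (k : ℕ) :
    Real.log (N k) ≤ k * Real.log (quot N k) := by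
  have := hN.log_mul_quot_pow_le k 0
  simpa [hN.zero_eq_one] using this

/-- Moderate growth bounds the quotient from above, p log ν_p ≤ log N_p + 2ap. Strong growth with A
= 2a + 1 bounds Qp log ν_{Qp} ≥ log N_{Qp} from below by Q(log N_p + (2a+1)p) - D. For p ≥ 2D the
difference log ν_{Qp} - log ν_p is at least 1/2. -/
theorem IsLC.beta3 (hN : IsLC N) (hmg : ModerateGrowth N) (hG : StrongGrowth N) : Beta3 N := by
  obtain ⟨a, ha, h⟩ := hmg.exists_log hN.pos
  obtain ⟨Q, hQ, D, hD, H⟩ := hG (2 * a + 1)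
  have hQ' : (1 : ℝ) ≤ Q := Nat.one_le_cast.2 hQ
  refine ⟨Q, hQ, ?_⟩
  have h1 : (1 : ℝ≥0∞) < ENNReal.ofReal (Real.exp (1 / 2)) := by
    rw [← ENNReal.ofReal_one, ENNReal.ofReal_lt_ofReal_iff (Real.exp_pos _)]
    exact Real.one_lt_exp_iff.2 one_half_pos
  refine h1.trans_le (le_liminf_of_le (by isBoundedDefault) ?_)
  obtain ⟨n, hn⟩ := exists_nat_ge (2 * D)
  filter_upwards [eventually_ge_atTop (max n 1)] with p hp
  have hp1 : (1 : ℝ) ≤ p := Nat.one_le_cast.2 ((le_max_right _ _).trans hp)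
  have hpD : 2 * D ≤ p := hn.trans (Nat.cast_le.2 ((le_max_left _ _).trans hp))
  refine ENNReal.ofReal_le_ofReal ?_
  rw [← Real.le_log_iff_exp_le (div_pos (hN.quot_pos _) (hN.quot_pos _)),
    Real.log_div (hN.quot_pos _).ne' (hN.quot_pos _).ne']
  have h2 := hN.log_le_mul_log_quot (Q * p)
  have h3 := hN.log_mul_quot_pow_le p (p + p)
  have h4 := h p p
  have h5 := H p
  have h6 : p * Real.log (quot N p) ≤ Real.log (N p) + 2 * a * p := by
    push_cast at h3
    linarith
  have h7 := mul_le_mul_of_nonneg_left h6 (zero_le_one.trans hQ')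
  push_cast at h2
  have hpos : (0 : ℝ) < Q * p := by positivity
  have h8 : (Q * p : ℝ) * (1 / 2) ≤
      Q * p * (Real.log (quot N (Q * p)) - Real.log (quot N p)) := by
    nlinarith
  exact le_of_mul_le_mul_left h8 hpos

/-! ### The associated function -/

theorem log_assoc_term (hN : IsLC N) {t : ℝ} (ht : 0 < t) (p : ℕ) :
    Real.log (t ^ p * N 0 / N p) = p * Real.log t - Real.log (N p) := by
  rw [hN.zero_eq_one, mul_one, Real.log_div (pow_pos ht p).ne' (hN.pos p).ne', Real.log_pow]

theorem IsLC.le_assoc (hN : IsLC N) {t : ℝ} (ht : 0 < t) (p : ℕ) :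
    p * Real.log t - Real.log (N p) ≤ assoc N t := by
  rw [assoc, if_pos ht, ← log_assoc_term hN ht]
  exact le_ciSup (bddAbove_assoc hN ht) p

theorem IsLC.assoc_le (hN : IsLC N) {t B : ℝ} (ht : 0 < t)
    (h : ∀ p : ℕ, p * Real.log t - Real.log (N p) ≤ B) : assoc N t ≤ B := by
  rw [assoc, if_pos ht]
  exact ciSup_le fun p => (log_assoc_term hN ht p).trans_le (h p)

theorem IsLC.assoc_nonneg (hN : IsLC N) {t : ℝ} (ht : 0 ≤ t) : 0 ≤ assoc N t := by
  rcases ht.eq_or_lt with rfl | ht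
  · simp [assoc]
  · simpa [hN.zero_eq_one] using hN.le_assoc ht 0

theorem IsLC.assoc_eq_zero (hN : IsLC N) {t : ℝ} (ht : t ≤ 1) : assoc N t = 0 := by
  rcases le_or_gt t 0 with h0 | h0
  · rw [assoc, if_neg h0.not_gt]
  · refine le_antisymm (hN.assoc_le h0 fun p => ?_) (hN.assoc_nonneg h0.le)
    have h1 := mul_nonpos_of_nonneg_of_nonpos (Nat.cast_nonneg (α := ℝ) p)
      (Real.log_nonpos h0.le ht)
    linarith [hN.log_nonneg p]

theorem IsLC.assoc_mono (hN : IsLC N) : MonotoneOn (assoc N) (Set.Ici 0) := by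
  intro s hs t _ hst
  rcases (Set.mem_Ici.1 hs).eq_or_lt with rfl | h0
  · rw [hN.assoc_eq_zero zero_le_one]
    exact hN.assoc_nonneg hst
  · refine hN.assoc_le h0 fun p => le_trans ?_ (hN.le_assoc (h0.trans_le hst) p)
    have := Real.log_le_log h0 hst
    gcongr

theorem IsLC.assoc_exp_convex (hN : IsLC N) :
    ConvexOn ℝ Set.univ fun t : ℝ => assoc N (Real.exp t) := by
  refine ⟨convex_univ, fun x _ y _ a b ha hb hab => hN.assoc_le (Real.exp_pos _) fun p => ?_⟩
  have h1 := mul_le_mul_of_nonneg_left (hN.le_assoc (Real.exp_pos x) p) ha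
  have h2 := mul_le_mul_of_nonneg_left (hN.le_assoc (Real.exp_pos y) p) hb
  have h3 : Real.log (N p) = a * Real.log (N p) + b * Real.log (N p) := by
    rw [← add_mul, hab, one_mul]
  rw [Real.log_exp] at *
  simp only [smul_eq_mul]
  linarith

theorem IsLC.assoc_continuousOn (hN : IsLC N) : ContinuousOn (assoc N) (Set.Ici 0) := by
  intro t ht
  rcases (Set.mem_Ici.1 ht).eq_or_lt with rfl | h0
  · have h1 : assoc N =ᶠ[𝓝 0] fun _ => 0 := by
      filter_upwards [gt_mem_nhds (zero_lt_one (α := ℝ))] with s hs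
      exact hN.assoc_eq_zero hs.le
    exact (continuousAt_const.congr h1.symm).continuousWithinAt
  · have hc : Continuous fun s : ℝ => assoc N (Real.exp s) :=
      continuousOn_univ.1 (hN.assoc_exp_convex.continuousOn isOpen_univ)
    have h1 : (fun s : ℝ => assoc N (Real.exp (Real.log s))) =ᶠ[𝓝 t] assoc N := by
      filter_upwards [lt_mem_nhds h0] with s hs
      rw [Real.exp_log hs]
    exact ((hc.continuousAt.comp (Real.continuousAt_log h0.ne')).congr h1).continuousWithinAt

theorem IsLC.log_isLittleO_assoc (hN : IsLC N) : Real.log =o[atTop] assoc N := by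
  refine isLittleO_iff.2 fun c hc => ?_
  obtain ⟨p, hp⟩ := exists_nat_ge (2 / c)
  rw [div_le_iff₀ hc] at hp
  filter_upwards [eventually_ge_atTop 1,
    Real.tendsto_log_atTop.eventually_ge_atTop (c * Real.log (N p))] with t ht1 ht2
  rw [Real.norm_of_nonneg (Real.log_nonneg ht1),
    Real.norm_of_nonneg (hN.assoc_nonneg (by linarith))]
  have h1 := mul_le_mul_of_nonneg_left (hN.le_assoc (by linarith : 0 < t) p) hc.le
  have h2 := mul_le_mul_of_nonneg_right hp (Real.log_nonneg ht1)
  linarith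

theorem IsLC.assoc_tendsto (hN : IsLC N) : Tendsto (assoc N) atTop atTop := by
  refine tendsto_atTop_mono' _ ?_
    (tendsto_atTop_add_const_right atTop (-Real.log (N 1)) Real.tendsto_log_atTop)
  filter_upwards [eventually_gt_atTop 0] with t ht
  simpa [sub_eq_add_neg] using hN.le_assoc ht 1

/-- The index k is rounded down to Qj with j = ⌊k/Q⌋. Strong growth with A = log 2 turns the term at
Qj for 2t into Q times the term at j for t, and the rounding costs Q log(2t), which ω_N(t) controls
through its term p = 1. -/
theorem IsLC.assoc_om1 (hN : IsLC N) (hG : StrongGrowth N) :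
    (fun t => assoc N (2 * t)) =O[atTop] assoc N := by
  obtain ⟨Q, hQ, D, hD, H⟩ := hG (Real.log 2)
  have hQ' : (0 : ℝ) < Q := Nat.cast_pos.2 hQ
  refine IsBigO.of_bound (2 * Q + 1) ?_
  filter_upwards [eventually_ge_atTop 1,
    hN.assoc_tendsto.eventually_ge_atTop (D + Q * (Real.log 2 + Real.log (N 1)))] with t ht1 ht2
  have ht0 : 0 < t := by linarith
  rw [Real.norm_of_nonneg (hN.assoc_nonneg (by positivity)),
    Real.norm_of_nonneg (hN.assoc_nonneg ht0.le)]
  have hlog : Real.log (2 * t) = Real.log 2 + Real.log t := Real.log_mul two_ne_zero ht0.ne'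
  have hlog0 : 0 ≤ Real.log (2 * t) := Real.log_nonneg (by linarith)
  have h1 := mul_le_mul_of_nonneg_left (hN.le_assoc ht0 1) hQ'.le
  refine hN.assoc_le (by positivity) fun k => ?_
  have hk : (k : ℝ) ≤ Q * (k / Q : ℕ) + Q := by
    exact_mod_cast (Nat.lt_mul_div_succ k hQ).le.trans_eq (by ring)
  have h2 := mul_le_mul_of_nonneg_right hk hlog0
  have h3 : Real.log (N (Q * (k / Q))) ≤ Real.log (N k) :=
    Real.log_le_log (hN.pos _) (hN.mono (Nat.mul_div_le k Q))
  have h4 := mul_le_mul_of_nonneg_left (hN.le_assoc ht0 (k / Q)) hQ'.le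
  have h5 := H (k / Q)
  rw [hlog] at h2 ⊢
  push_cast at h1
  linarith

theorem IsLC.isW_assoc (hN : IsLC N) (hG : StrongGrowth N) : IsW (assoc N) where
  nonneg _ ht := hN.assoc_nonneg ht
  cont := hN.assoc_continuousOn
  mono := hN.assoc_mono
  zero_on _ ht := hN.assoc_eq_zero ht.2
  tendsto := hN.assoc_tendsto
  om1 := hN.assoc_om1 hG
  om3 := hN.log_isLittleO_assoc
  om4 := hN.assoc_exp_convex

/-- By (mg), the terms with indices j and k at t add up to at most the term with index j + k at e^a
t; suprema over j and then k give 2ω_N(t). -/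
theorem IsLC.assoc_om6 (hN : IsLC N) (hmg : ModerateGrowth N) : Om6 (assoc N) := by
  obtain ⟨a, ha, h⟩ := hmg.exists_log hN.pos
  refine ⟨Real.exp a, Real.one_le_exp ha, fun t ht => ?_⟩
  have hE := Real.exp_pos a
  rcases ht.eq_or_lt with rfl | ht
  · rw [mul_zero, hN.assoc_eq_zero zero_le_one]
    linarith
  · have h1 : ∀ j k : ℕ, j * Real.log t - Real.log (N j) ≤
        assoc N (Real.exp a * t) - (k * Real.log t - Real.log (N k)) := fun j k => by
      have h2 := hN.le_assoc (mul_pos hE ht) (j + k)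
      rw [Real.log_mul hE.ne' ht.ne', Real.log_exp] at h2
      have h3 := h j k
      push_cast at h2
      linarith
    have h4 : ∀ k : ℕ, k * Real.log t - Real.log (N k) ≤
        assoc N (Real.exp a * t) - assoc N t := fun k => by
      linarith [hN.assoc_le ht fun j => h1 j k]
    linarith [hN.assoc_le ht h4]

/-- This is biduality for the log-convex N: the supremum defining φ*(k) is attained at y = log ν_k,
which is admissible because ν_k ≥ 1. -/
theorem IsLC.Omega_assoc_one (hN : IsLC N) (hG : StrongGrowth N) : Omega (assoc N) 1 = N := by
  funext k
  rw [Omega_eq, div_one, one_mul, ← Real.exp_log (hN.pos k), Real.exp_eq_exp]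
  refine le_antisymm (young_le fun y _ => ?_) ?_
  · have := hN.le_assoc (Real.exp_pos y) k
    rw [Real.log_exp] at this
    linarith
  · have hq := hN.quot_pos k
    have h1 := (hN.isW_assoc hG).le_young (x := k) (Real.log_nonneg (hN.one_le_quot k))
    rw [Real.exp_log hq] at h1
    have h2 : assoc N (quot N k) ≤ k * Real.log (quot N k) - Real.log (N k) :=
      hN.assoc_le hq fun p => by linarith [hN.log_mul_quot_pow_le k p]
    linarith

theorem IsLC.sameClass_assoc (hN : IsLC N) (hmg : ModerateGrowth N) (hG : StrongGrowth N)
    (τ : ClassType) : SameClass (weightClass (assoc N) τ) (seqClass N τ) := by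
  have := (hN.isW_assoc hG).sameClass_Omega_weight (hN.assoc_om6 hmg) one_pos τ
  rw [hN.Omega_assoc_one hG] at this
  exact this.symm

end LC

/-! ### Comparison with factorials -/

/-- The sequence `k!`. -/
def fact (k : ℕ) : ℝ := (k ! : ℝ)

theorem SeqLE.exists_dominated_scaled {a M N : ℕ → ℝ} (hM : ∀ k, 0 < M k) (h : SeqLE M N)
    (H : ∃ x : ℝ, 0 < x ∧ Dominated a (scaled M x)) : ∃ x : ℝ, 0 < x ∧ Dominated a (scaled N x) := by
  obtain ⟨x, hx, H⟩ := H
  obtain ⟨y, hy⟩ := h.famLE .roumieu ⟨x, hx⟩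
  exact ⟨y, y.2, H.trans (fun k => (scaled_pos hM hx k).le) hy⟩

theorem SeqLE.forall_dominated_scaled {a M N : ℕ → ℝ} (hM : ∀ k, 0 < M k) (h : SeqLE M N)
    (H : ∀ x : ℝ, 0 < x → Dominated a (scaled M x)) (y : ℝ) (hy : 0 < y) :
    Dominated a (scaled N y) := by
  obtain ⟨x, hx⟩ := h.famLE .beurling ⟨y, hy⟩
  exact (H x x.2).trans (fun k => (scaled_pos hM x.2 k).le) hx

/-- The domination constant is eventually below 2^k, which accounts for the factor 2. -/
theorem eventually_le_smallRoot {M : ℕ → ℝ} (hM : ∀ k, 0 < M k) {h : ℝ} (hh : 0 < h)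
    (H : Dominated fact (scaled M h)) : ∀ᶠ k in atTop, 1 / (2 * h) ≤ smallRoot M k := by
  obtain ⟨C, hC⟩ := H
  filter_upwards [(tendsto_pow_atTop_atTop_of_one_lt (one_lt_two (α := ℝ))).eventually_ge_atTop C,
    eventually_ge_atTop 1] with k hk hk1
  have hf : (0 : ℝ) < k ! := Nat.cast_pos.2 k.factorial_pos
  have h1 : (1 / (2 * h)) ^ k ≤ M k / k ! := by
    rw [le_div_iff₀ hf, div_pow, one_pow, mul_pow, div_mul_eq_mul_div, one_mul,
      div_le_iff₀ (by positivity)]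
    calc (k ! : ℝ) ≤ C * (h ^ k * M k) := hC k
      _ ≤ 2 ^ k * (h ^ k * M k) := by
        have := hM k
        gcongr
      _ = M k * (2 ^ k * h ^ k) := by ring
  calc 1 / (2 * h) = ((1 / (2 * h)) ^ k) ^ (1 / (k : ℝ)) := by
        rw [one_div (k : ℝ), Real.pow_rpow_inv_natCast (by positivity) (by omega)]
    _ ≤ _ := Real.rpow_le_rpow (by positivity) h1 (by positivity)

theorem liminfPos_of_dominated {M : ℕ → ℝ} (hM : ∀ k, 0 < M k)
    (H : ∃ h : ℝ, 0 < h ∧ Dominated fact (scaled M h)) : LiminfPos M := by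
  obtain ⟨h, hh, H⟩ := H
  have h1 : (0 : ℝ≥0∞) < ENNReal.ofReal (1 / (2 * h)) := ENNReal.ofReal_pos.2 (by positivity)
  refine h1.trans_le (le_liminf_of_le (by isBoundedDefault) ?_)
  filter_upwards [eventually_le_smallRoot hM hh H] with k hk
  exact ENNReal.ofReal_le_ofReal hk

theorem limInfty_of_dominated {M : ℕ → ℝ} (hM : ∀ k, 0 < M k)
    (H : ∀ h : ℝ, 0 < h → Dominated fact (scaled M h)) : LimInfty M := by
  refine tendsto_atTop.2 fun b => ?_
  have hb : 0 < |b| + 1 := by positivity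
  filter_upwards [eventually_le_smallRoot hM (h := 1 / (2 * (|b| + 1))) (by positivity)
    (H _ (by positivity))] with k hk
  refine le_trans ?_ hk
  rw [show 1 / (2 * (1 / (2 * (|b| + 1)))) = |b| + 1 by field_simp]
  linarith [le_abs_self b]

/-- Each t^p / M_p is at most C (ht)^p / p! ≤ C e^{ht}, and log C ≤ ht for large t. -/
theorem IsLC.eventually_assoc_le {M : ℕ → ℝ} (hM : IsLC M) {h : ℝ} (hh : 0 < h)
    (H : Dominated fact (scaled M h)) : ∀ᶠ t : ℝ in atTop, ‖assoc M t‖ ≤ 2 * h * ‖t‖ := by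
  obtain ⟨C, hC⟩ := H
  have hC0 : 0 < C := by
    have := hC 0
    simp only [fact, scaled, Nat.factorial_zero, Nat.cast_one, pow_zero, hM.zero_eq_one] at this
    linarith
  filter_upwards [eventually_gt_atTop 0, eventually_ge_atTop (Real.log C / h)] with t ht htC
  rw [Real.norm_of_nonneg ht.le, Real.norm_of_nonneg (hM.assoc_nonneg ht.le)]
  rw [div_le_iff₀ hh] at htC
  refine hM.assoc_le ht fun p => ?_
  have hf : (0 : ℝ) < p ! := Nat.cast_pos.2 p.factorial_pos
  have h1 : t ^ p / M p ≤ C * Real.exp (h * t) := by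
    calc t ^ p / M p ≤ C * ((h * t) ^ p / p !) := by
          rw [div_le_iff₀ (hM.pos p), mul_div_assoc', div_mul_eq_mul_div, le_div_iff₀ hf]
          calc t ^ p * (p ! : ℝ) ≤ t ^ p * (C * (h ^ p * M p)) := by
                gcongr
                exact hC p
            _ = _ := by rw [mul_pow]; ring
      _ ≤ _ := by
          gcongr
          exact Real.pow_div_factorial_le_exp _ (by positivity) p
  have h2 := Real.log_le_log (div_pos (pow_pos ht p) (hM.pos p)) h1
  rw [Real.log_div (pow_pos ht p).ne' (hM.pos p).ne', Real.log_pow,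
    Real.log_mul hC0.ne' (Real.exp_pos _).ne', Real.log_exp] at h2
  linarith

theorem IsLC.om2_assoc {M : ℕ → ℝ} (hM : IsLC M)
    (H : ∃ h : ℝ, 0 < h ∧ Dominated fact (scaled M h)) : Om2 (assoc M) := by
  obtain ⟨h, hh, H⟩ := H
  exact IsBigO.of_bound _ (hM.eventually_assoc_le hh H)

theorem IsLC.om5_assoc {M : ℕ → ℝ} (hM : IsLC M)
    (H : ∀ h : ℝ, 0 < h → Dominated fact (scaled M h)) : Om5 (assoc M) := by
  refine isLittleO_iff.2 fun c hc => ?_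
  have := hM.eventually_assoc_le (half_pos hc) (H _ (half_pos hc))
  rwa [mul_div_cancel₀ _ two_ne_zero] at this

/-- From ω(t) ≤ ct + const, testing at y = log(x/c) gives φ*(x) ≥ x log(x/c) - x - const. With x =
lk and k! ≤ k^k this is the assertion. -/
theorem IsW.dominated_fact_Omega {ω : ℝ → ℝ} (hω : IsW ω) {c l : ℝ} (hc : 0 < c) (hl : 0 < l)
    (h : ∀ᶠ t : ℝ in atTop, ‖ω t‖ ≤ c * ‖t‖) :
    Dominated fact (scaled (Omega ω l) (c * Real.exp 1 / l)) := by
  obtain ⟨A, hA⟩ := eventually_atTop.1 h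
  have hD : ∀ t, 0 ≤ t → ω t ≤ c * t + ω |A| := fun t ht => by
    rcases le_total A t with h1 | h1
    · have h2 := hA t h1
      rw [Real.norm_of_nonneg (hω.nonneg t ht), Real.norm_of_nonneg ht] at h2
      linarith [hω.nonneg |A| (abs_nonneg A)]
    · have := hω.mono (Set.mem_Ici.2 ht) (Set.mem_Ici.2 (abs_nonneg A)) (h1.trans (le_abs_self A))
      linarith [mul_nonneg hc.le ht]
  have hA0 := hω.nonneg |A| (abs_nonneg A)
  have hy : ∀ x, 0 < x → x * Real.log (x / c) - x ≤ young ω x + ω |A| := fun x hx => by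
    -- For x ≤ c the point log(x/c) is not positive and need not be admissible, but the left side is
    -- then negative.
    rcases le_total x c with h1 | h1
    · have h2 := Real.log_nonpos (by positivity) ((div_le_one hc).2 h1)
      have := hω.young_nonneg x
      nlinarith
    · have h2 := hω.le_young (x := x) (Real.log_nonneg ((one_le_div hc).2 h1))
      rw [Real.exp_log (by positivity)] at h2
      have h3 := hD (x / c) (by positivity)
      rw [mul_div_cancel₀ _ hc.ne'] at h3
      linarith
  refine ⟨Real.exp (ω |A| / l), fun k => ?_⟩
  rcases Nat.eq_zero_or_pos k with rfl | hk
  · simp only [fact, scaled, Nat.factorial_zero, Nat.cast_one, pow_zero,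
      (hω.isLC_Omega hl).zero_eq_one, mul_one]
    exact Real.one_le_exp (by positivity)
  · have hk' : (0 : ℝ) < k := Nat.cast_pos.2 hk
    have h1 : fact k ≤ (k : ℝ) ^ k := by
      unfold fact
      exact_mod_cast Nat.factorial_le_pow k
    have h2 := hy (l * k) (by positivity)
    refine h1.trans ?_
    have h3 : (0 : ℝ) < (c * Real.exp 1 / l) ^ k := by positivity
    rw [← Real.log_le_log_iff (by positivity)
      (mul_pos (Real.exp_pos _) (scaled_pos (Omega_pos ω l) (by positivity) k)), scaled,
      Real.log_mul (Real.exp_pos _).ne' (mul_pos h3 (Omega_pos ω l k)).ne', Real.log_exp,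
      Real.log_mul h3.ne' (Omega_pos ω l k).ne', log_Omega, Real.log_pow, Real.log_pow,
      Real.log_div (by positivity) hl.ne', Real.log_mul hc.ne' (Real.exp_pos _).ne', Real.log_exp]
    rw [Real.log_div (by positivity) hc.ne', Real.log_mul hl.ne' hk'.ne'] at h2
    have h4 : k * (Real.log l + Real.log k - Real.log c) - k ≤
        (young ω (l * k) + ω |A|) / l := by
      rw [le_div_iff₀ hl]
      linarith
    rw [add_div] at h4
    linarith

theorem IsW.exists_dominated_fact {ω : ℝ → ℝ} (hω : IsW ω) (h2 : Om2 ω) {l : ℝ} (hl : 0 < l) :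
    ∃ h : ℝ, 0 < h ∧ Dominated fact (scaled (Omega ω l) h) := by
  obtain ⟨c, hc, h⟩ := h2.exists_pos
  exact ⟨c * Real.exp 1 / l, by positivity, hω.dominated_fact_Omega hc hl h.bound⟩

theorem IsW.forall_dominated_fact {ω : ℝ → ℝ} (hω : IsW ω) (h5 : Om5 ω) {l : ℝ} (hl : 0 < l)
    (h : ℝ) (hh : 0 < h) : Dominated fact (scaled (Omega ω l) h) := by
  have hc : 0 < h * l / Real.exp 1 := by positivity
  have := hω.dominated_fact_Omega hc hl (h5.def hc)
  rwa [div_mul_cancel₀ _ (Real.exp_pos 1).ne', mul_div_cancel_right₀ _ hl.ne'] at this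

theorem IsW.om6_of_seqEquiv {ω : ℝ → ℝ} (hω : IsW ω) {N : ℕ → ℝ}
    (h : ∀ l : ℝ, 0 < l → SeqEquiv N (Omega ω l)) : Om6 ω :=
  hω.om6_of_seqLE one_pos ((h (4 * 1) (by norm_num)).2.trans (h 1 one_pos).1)

end Ultra

end

open Ultra
theorem mainTheorem7 (ω : ℝ → ℝ) (hω : IsW ω) :
    -- the equivalence of (i), (ii), (iii) and of (iii) with `≈`, for each of the two types
    (∀ τ : ClassType, List.TFAE
      [∃ N : ℕ → ℝ, IsLC N ∧ SameClass (seqClass N τ) (weightClass ω τ) ∧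
          SameClass (weightClass ω τ) (matrixClass (OmegaMatrix ω) τ),
        Om6 ω,
        ∃ N : ℕ → ℝ, IsLC N ∧ ∀ l : ℝ, 0 < l →
          SameClass (seqClass (Omega ω l) τ) (seqClass N τ),
        ∃ N : ℕ → ℝ, IsLC N ∧ ∀ l : ℝ, 0 < l → SeqEquiv N (Omega ω l)]) ∧
    -- the two conditions in (iii) are equivalent for each `N` and each `l`
    (∀ τ : ClassType, ∀ N : ℕ → ℝ, IsLC N → ∀ l : ℝ, 0 < l →
      (SameClass (seqClass (Omega ω l) τ) (seqClass N τ) ↔ SeqEquiv N (Omega ω l))) ∧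
    -- the additional properties, for each `N` as in (i) or as in (iii)
    (∀ τ : ClassType, ∀ N : ℕ → ℝ, IsLC N →
      ((SameClass (seqClass N τ) (weightClass ω τ) ∧
          SameClass (weightClass ω τ) (matrixClass (OmegaMatrix ω) τ)) ∨
        (∀ l : ℝ, 0 < l → SameClass (seqClass (Omega ω l) τ) (seqClass N τ)) ∨
        (∀ l : ℝ, 0 < l → SeqEquiv N (Omega ω l))) →
      (ModerateGrowth N ∧ ∀ l : ℝ, 0 < l → ModerateGrowth (Omega ω l)) ∧
      (Om2 ω →
        LiminfPos N ∧ MatrixH (OmegaMatrix ω) ∧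
        (Om2 (assoc N) ∧ ∀ l : ℝ, 0 < l → Om2 (assoc (Omega ω l))) ∧
        (Beta3 N ∧ ∀ l : ℝ, 0 < l → Beta3 (Omega ω l)) ∧
        SameClass (weightClass (assoc N) τ) (seqClass N τ) ∧
        SameClass (seqClass N τ) (weightClass ω τ) ∧
        ∀ l : ℝ, 0 < l → SameClass (weightClass ω τ) (seqClass (Omega ω l) τ)) ∧
      (Om5 ω →
        LimInfty N ∧ MatrixBeurlingAnalytic (OmegaMatrix ω) ∧
        Om5 (assoc N) ∧ ∀ l : ℝ, 0 < l → Om5 (assoc (Omega ω l)))) := by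
  refine ⟨fun τ => ?_, fun τ N hN l hl => sameClass_seqClass_iff (hω.isLC_Omega hl) hN τ,
    fun τ N hN h => ?_⟩
  · tfae_have 1 → 2 := fun ⟨N, hN, h, _⟩ => (hω.om6_of_sameClass hN h).1
    tfae_have 2 → 1 := fun h6 => ⟨Omega ω 1, hω.isLC_Omega one_pos,
      hω.sameClass_Omega_weight h6 one_pos τ, hω.sameClass_weight_matrix τ⟩
    tfae_have 2 → 4 := fun h6 => ⟨Omega ω 1, hω.isLC_Omega one_pos, fun l hl =>
      hω.seqEquiv_Omega h6 one_pos hl⟩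
    tfae_have 4 → 2 := fun ⟨N, _, h⟩ => hω.om6_of_seqEquiv h
    tfae_have 3 ↔ 4 := exists_congr fun N => and_congr_right fun hN => forall₂_congr fun l hl =>
      sameClass_seqClass_iff (hω.isLC_Omega hl) hN τ
    tfae_finish
  -- All three descriptions of N reduce to (ω₆) together with N ≈ Ω^l for every l.
  · obtain ⟨h6, hequiv⟩ : Om6 ω ∧ ∀ l : ℝ, 0 < l → SeqEquiv N (Omega ω l) := by
      rcases h with h | h | h
      · exact hω.om6_of_sameClass hN h.1
      · have h' : ∀ l : ℝ, 0 < l → SeqEquiv N (Omega ω l) := fun l hl =>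
          (sameClass_seqClass_iff (hω.isLC_Omega hl) hN τ).1 (h l hl)
        exact ⟨hω.om6_of_seqEquiv h', h'⟩
      · exact ⟨hω.om6_of_seqEquiv h, h⟩
    have hO : ∀ l : ℝ, 0 < l → IsLC (Omega ω l) := fun l hl => hω.isLC_Omega hl
    have hmgO : ∀ l : ℝ, 0 < l → ModerateGrowth (Omega ω l) := fun l hl =>
      hω.moderateGrowth_Omega h6 hl
    have hmg : ModerateGrowth N := (hmgO 1 one_pos).of_seqEquiv (hO 1 one_pos) hN (hequiv 1 one_pos)
    have hG : StrongGrowth N := hω.strongGrowth hN.pos (hequiv 1 one_pos)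
    have hGO : ∀ l : ℝ, 0 < l → StrongGrowth (Omega ω l) := fun l hl =>
      hω.strongGrowth (hO l hl).pos (hω.seqEquiv_Omega h6 hl one_pos)
    have hle : SeqLE (Omega ω 1) N := (hequiv 1 one_pos).2
    have hOω : ∀ l : ℝ, 0 < l → SameClass (seqClass (Omega ω l) τ) (weightClass ω τ) :=
      fun l hl => hω.sameClass_Omega_weight h6 hl τ
    refine ⟨⟨hmg, hmgO⟩, fun h2 => ?_, fun h5 => ?_⟩
    · have hfN := hle.exists_dominated_scaled (Omega_pos ω 1) (hω.exists_dominated_fact h2 one_pos)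
      exact ⟨liminfPos_of_dominated hN.pos hfN,
        fun l => liminfPos_of_dominated (Omega_pos ω l) (hω.exists_dominated_fact h2 l.2),
        ⟨hN.om2_assoc hfN, fun l hl => (hO l hl).om2_assoc (hω.exists_dominated_fact h2 hl)⟩,
        ⟨hN.beta3 hmg hG, fun l hl => (hO l hl).beta3 (hmgO l hl) (hGO l hl)⟩,
        hN.sameClass_assoc hmg hG τ,
        ((hequiv 1 one_pos).sameClass hN.pos (Omega_pos ω 1) τ).trans (hOω 1 one_pos),
        fun l hl => (hOω l hl).symm⟩
    · have hfN := hle.forall_dominated_scaled (Omega_pos ω 1) (hω.forall_dominated_fact h5 one_pos)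
      exact ⟨limInfty_of_dominated hN.pos hfN,
        fun l => limInfty_of_dominated (Omega_pos ω l) (hω.forall_dominated_fact h5 l.2),
        hN.om5_assoc hfN, fun l hl => (hO l hl).om5_assoc (hω.forall_dominated_fact h5 hl)⟩
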